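/- Work in the complex projective plane $\mathbb P^2$ with homogeneous coordinates $[x:y:z]$, put $\ell_\infty=V(z)$, $I=[1:i:0]$, $J=[1:-i:0]$, and for four points $P_k=[a_k:b_k:0]$ of $\ell_\infty$, each appearing at most twice, let $$\beta(P_1,P_2,P_3,P_4)=\frac{(b_3a_1-b_1a_3)(b_4a_2-b_2a_4)}{(b_3a_2-b_2a_3)(b_4a_1-b_1a_4)}\in\mathbb C\cup\{\infty\}.$$ Let $\mathcal C=V(F)$, where $F\in\mathbb C[x,y,z]$ is an irreducible homogeneous polynomial of degree $d\ge 2$, and let $S=[x_0:y_0:z_0]\in\mathbb P^2$. For $m\in\mathcal C\setminus(\{S\}\cup\ell_\infty\cup V(F_x^2+F_y^2))$ let $\mathcal R_m$ be the reflected line at $m$ of the incident line $(mS)$, that is, the line through $m$ whose point at infinity $r$ satisfies $\beta(s,t,I,J)=\beta(t,r,I,J)$, where $s$ and $t$ are the points at infinity of $(mS)$ and of the tangent line $\mathcal T_m\mathcal C$. The caustic by reflection $\Sigma_S(\mathcal C)$ is the Zariski closure of the envelope of the lines $\mathcal R_m$; the envelope consists of the points of contact, the point of contact of $\mathcal R_m$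 being its intersection with the infinitely near reflected line, wherever the family is immersive (if $\lambda(t)$ is the vector of coefficients of an equation of $\mathcal R_{\gamma(t)}$ along an analytic arc $\gamma$ on $\mathcal C$ with $\gamma(0)=m$, and $\lambda(0),\lambda'(0)$ are linearly independent, it is the point $P$ with $\lambda(0)\cdot P=\lambda'(0)\cdot P=0$). Let $T_{\mathcal C,S}$ be the restriction to $\mathcal C$ of the rational map $m\mapsto[u_m:v_m:w_m]$ (with values in the dual plane, $[a:b:c]$ being the line $aX+bY+cZ=0$), where, with $\Delta_SF=x_0F_x+y_0F_y+z_0F_z$, \begin{align*} u_m&=(z_0y-zy_0)(F_x^2+F_y^2)+2z\,\Delta_SF\,F_y,\\ v_m&=(zx_0-z_0x)(F_x^2+F_y^2)-2z\,\Delta_SF\,F_x,\\ w_m&=(xy_0-yx_0)(F_x^2+F_y^2)-2\,\Delta_SF\,(xF_y-yF_x). \end{align*} The class of a plane curve is the degree of its dual curve, the Zariski closure of the set of its tangent lines at nonsingular points. Assume that $\Sigma_S(\mathcal C)$ is not reduced to a point. Then $\Sigma_S(\mathcal C)$ and the Zariski closure $\overline{T_{\mathcal C,S}(\mathcal C)}$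 are irreducible curves, and $$\mathrm{class}(\Sigma_S(\mathcal C))=\deg\overline{T_{\mathcal C,S}(\mathcal C)}.$$ Moreover, $T_{\mathcal C,S}$ is the composition of the caustic map with the Gauss map of $\Sigma_S(\mathcal C)$: for all but finitely many $m\in\mathcal C$, there is exactly one point of contact of $\mathcal R_m$ at $m$, it is a nonsingular point of $\Sigma_S(\mathcal C)$, and the tangent line to $\Sigma_S(\mathcal C)$ there is $T_{\mathcal C,S}(m)$. -/

import Mathlib

open scoped Matrix LinearAlgebra.Projectivization Topology

namespace Caustic

/-- Vectors of `ℂ³`: homogeneous coordinates of points, or coefficients of equations of lines. -/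
abbrev Vec : Type := Fin 3 → ℂ

/-- The complex projective plane. It also serves as the dual plane:
the line `aX + bY + cZ = 0` is the point `[a : b : c]`. -/
abbrev Plane : Type := ℙ ℂ Vec

/-- Polynomials in the homogeneous coordinates `x, y, z` (indices `0, 1, 2`). -/
abbrev Form : Type := MvPolynomial (Fin 3) ℂ

noncomputable section

/-! Plane algebraic geometry. -/

/-- The projective zero locus `V(G)` (used for homogeneous `G`, for which it does not depend on
the representatives). -/
def zeroLocus (G : Form) : Set Plane := {P | MvPolynomial.eval P.rep G = 0}

/-- The Zariski closure: the common zeros of all homogeneous polynomials vanishing on `A`. -/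
def zariskiClosure (A : Set Plane) : Set Plane :=
  {P | ∀ (G : Form) (n : ℕ), G.IsHomogeneous n → A ⊆ zeroLocus G → P ∈ zeroLocus G}

/-- The gradient `(G_x, G_y, G_z)` at `v`. -/
def grad (G : Form) (v : Vec) : Vec := fun i => MvPolynomial.eval v (MvPolynomial.pderiv i G)

/-- `G` is a reduced equation, of degree `n`, of the set `Z`. -/
def IsReducedEquation (G : Form) (n : ℕ) (Z : Set Plane) : Prop :=
  G.IsHomogeneous n ∧ Squarefree G ∧ Z = zeroLocus G

/-- `Z` is an irreducible plane algebraic curve. -/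
def IsIrreducibleCurve (Z : Set Plane) : Prop :=
  ∃ (G : Form) (n : ℕ), G.IsHomogeneous n ∧ Irreducible G ∧ Z = zeroLocus G

/-- The degree of a plane curve, i.e. the degree of its reduced equation
(`0` if `Z` is not a curve; in particular `0` if `Z` is finite). -/
def curveDegree (Z : Set Plane) : ℕ := sInf {n | ∃ G, IsReducedEquation G n Z}

/-- `P` is a nonsingular point of the curve `Z` and `L`, seen as a point of the dual plane, is the
tangent line to `Z` at `P`. In other words, `L` is the image of `P` by the Gauss map of `Z`. -/
def IsTangentLine (Z : Set Plane) (P L : Plane) : Prop :=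
  P ∈ Z ∧ ∃ (G : Form) (n : ℕ), IsReducedEquation G n Z ∧
    ∃ h : grad G P.rep ≠ 0, L = Projectivization.mk ℂ (grad G P.rep) h

/-- The dual curve: the Zariski closure of the image of the Gauss map. -/
def dualCurve (Z : Set Plane) : Set Plane := zariskiClosure {L | ∃ P, IsTangentLine Z P L}

/-- The class of a plane curve: the degree of its dual curve. -/
def curveClass (Z : Set Plane) : ℕ := curveDegree (dualCurve Z)

/-! Reflection. -/

/-- The cross-ratio of four points `[aᵢ : bᵢ : 0]` of the line at infinity, with `1/0 = ∞`. -/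
def crossRatio (P₁ P₂ P₃ P₄ : ℂ × ℂ) : OnePoint ℂ :=
  open Classical in
  if (P₃.2 * P₂.1 - P₂.2 * P₃.1) * (P₄.2 * P₁.1 - P₁.2 * P₄.1) = 0 then OnePoint.infty
  else
    (((P₃.2 * P₁.1 - P₁.2 * P₃.1) * (P₄.2 * P₂.1 - P₂.2 * P₄.1) /
      ((P₃.2 * P₂.1 - P₂.2 * P₃.1) * (P₄.2 * P₁.1 - P₁.2 * P₄.1)) : ℂ) : OnePoint ℂ)

/-- The cyclic point `I = [1 : i : 0]`. -/
def cyclicI : ℂ × ℂ := (1, Complex.I)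

/-- The cyclic point `J = [1 : -i : 0]`. -/
def cyclicJ : ℂ × ℂ := (1, -Complex.I)

/-- The point at infinity `[b : -a : 0]` of the line `aX + bY + cZ = 0`
(distinct from the line at infinity). -/
def pointAtInfinity (l : Vec) : ℂ × ℂ := (l 1, -l 0)

/-- The value at `m` of `Q(∇F) = F_x² + F_y²`. -/
def gradQ (F : Form) (m : Vec) : ℂ := grad F m 0 ^ 2 + grad F m 1 ^ 2

/-- `m` represents a point of `V(F)` outside `{S} ∪ ℓ_∞ ∪ V(Q(∇F))`: a point at which the reflected
line is defined. -/
def IsMirrorPoint (F : Form) (S m : Vec) : Prop :=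
  MvPolynomial.eval m F = 0 ∧ (∀ c : ℂ, m ≠ c • S) ∧ m 2 ≠ 0 ∧ gradQ F m ≠ 0

/-- `l` is an equation of the reflected line at the mirror point `m` of the incident line `(mS)`
(which has equation `m ⨯₃ S`), the tangent line to the mirror at `m` having equation `grad F m`.
It is the line through `m` for which the Snell-Descartes law
`β(P, t, I, J) = β(t, R, I, J)` holds, with `P`, `t`, `R` the points at infinity of the incident,
tangent and reflected lines. -/
def IsReflectedLine (F : Form) (S m l : Vec) : Prop :=
  l ≠ 0 ∧ l ⬝ᵥ m = 0 ∧
    crossRatio (pointAtInfinity (m ⨯₃ S)) (pointAtInfinity (grad F m)) cyclicI cyclicJ =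
      crossRatio (pointAtInfinity (grad F m)) (pointAtInfinity l) cyclicI cyclicJ

/-- `P` is the point of contact with its envelope of the reflected line at `m`: along an analytic
arc `γ` of mirror points through `m`, with an analytic choice `l` of equations of the reflected
lines, `P` is the common point of the two (distinct) lines `l 0` and `l' 0`, i.e. the limit of the
intersection of the reflected line with an infinitely near one. -/
def IsCausticPoint (F : Form) (S m : Vec) (P : Plane) : Prop :=
  ∃ γ l : ℂ → Vec, AnalyticAt ℂ γ 0 ∧ AnalyticAt ℂ l 0 ∧ γ 0 = m ∧
    (∀ᶠ t in 𝓝 (0 : ℂ), IsMirrorPoint F S (γ t) ∧ IsReflectedLine F S (γ t) (l t)) ∧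
    LinearIndependent ℂ ![l 0, deriv l 0] ∧
    l 0 ⬝ᵥ P.rep = 0 ∧ deriv l 0 ⬝ᵥ P.rep = 0

/-- The caustic by reflection `Σ_S(C)`, for `C = V(F)`: the Zariski closure of the envelope of the
reflected lines. -/
def caustic (F : Form) (S : Vec) : Set Plane := zariskiClosure {P | ∃ m, IsCausticPoint F S m P}

/-- The vector `(u_m, v_m, w_m)` of homogeneous coordinates of `R_{C,S}(m)`. -/
def reflectedVec (F : Form) (S m : Vec) : Vec :=
  let x := m 0
  let y := m 1
  let z := m 2
  let x₀ := S 0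
  let y₀ := S 1
  let z₀ := S 2
  let Fx := grad F m 0
  let Fy := grad F m 1
  let D := S ⬝ᵥ grad F m
  ![(z₀ * y - z * y₀) * (Fx ^ 2 + Fy ^ 2) + 2 * z * D * Fy,
    (z * x₀ - z₀ * x) * (Fx ^ 2 + Fy ^ 2) - 2 * z * D * Fx,
    (x * y₀ - y * x₀) * (Fx ^ 2 + Fy ^ 2) - 2 * D * (x * Fy - y * Fx)]

/-- The rational map `T_{C,S}`, the restriction of `m ↦ [u_m : v_m : w_m]` to `C = V(F)`, is defined
at `m` by these coordinates, with value `L`. -/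
def IsReflectedImage (F : Form) (S : Vec) (m L : Plane) : Prop :=
  m ∈ zeroLocus F ∧
    ∃ h : reflectedVec F S m.rep ≠ 0, L = Projectivization.mk ℂ (reflectedVec F S m.rep) h

/-- The image `T_{C,S}(C)`. -/
def reflectedImage (F : Form) (S : Vec) : Set Plane := {L | ∃ m, IsReflectedImage F S m L}

end

end Caustic

/-!
Write `ρ` for the vector of forms `(u, v, w)` and `τ = (F_y, -F_x, 0)`, which is tangent to the
mirror in the affine planes `z = const`; let a dot denote the derivation `F_y ∂_x - F_x ∂_y`
along `τ` (`tangentDeriv`), which preserves the ideal `(F)`. At a mirror point the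
Snell-Descartes law is a linear condition on the reflected line, solved by `ρ(m)`
(`IsReflectedLine.cross_eq_zero`, `isReflectedLine_reflectedVec`). Since `F_x² + F_y² ≠ 0` there,
the mirror is nonsingular at `m`, and the velocity of every arc through `m` is a combination of
`m` and `τ(m)`. Hence the point of contact at `m` is `Φ(m)`, where `Φ = ρ × ρ̇`
(`isCausticPoint_iff`; the arc is given by the inverse function theorem), and the caustic is the
closure of the image of the mirror under the rational map `Φ`.

The closure of the image of the irreducible curve `V(F)` under a rational map is a point or an
irreducible curve `V(G)` such that a form vanishes on the image exactly when `G` divides it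
(`constant_or_exists_image_equation`). This rests on the Nullstellensatz, on the algebraic
dependence of three elements of the coordinate ring, and on the finiteness of intersections
(`finite_inter`). The map `ρ` is not constant, since otherwise the mirror would lie on a line. A
map `Ψ` such that `Ψ × Ψ̇` vanishes on the mirror is constant along analytic arcs, hence constant
(`constant_of_cross_tangentDeriv_eq_zero`); so `Φ` is not identically zero on the mirror and, as
the caustic is not a point, neither is `Φ × Φ̇`.

Duality is then the following computation. From `ρ · Φ = 0` and `ρ̇ · Φ = 0` one gets
`ρ · Φ̇ = 0`. Likewise, if `G` is the equation of the caustic, `∇G(Φ)` is orthogonal to `Φ` by Euler's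
identity and to `Φ̇` by differentiation of `G(Φ) ≡ 0` modulo `F`. As `Φ` and `Φ̇` are generically
independent, `∇G(Φ)` is proportional to `ρ` (`reflForms_cross_grad`), and it is generically
nonzero because `G` does not divide all its partial derivatives. So the tangent line to the
caustic at `Φ(m)` is `ρ(m)`, and a form vanishes on the tangent lines of the caustic exactly when
it vanishes on the image of `ρ` (`tangentLines_subset_iff`): the dual curve of the caustic is the
closure of that image.
-/

namespace Caustic

open MvPolynomial

/-! ### Plane curves: Nullstellensatz, elimination and finiteness of intersections -/

lemma eval_bind₁ {σ τ : Type*} (a : σ → MvPolynomial τ ℂ) (p : MvPolynomial σ ℂ) (v : τ → ℂ) :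
    eval v (bind₁ a p) = eval (fun i => eval v (a i)) p :=
  eval₂Hom_bind₁ _ _ _ _

lemma isHomogeneous_bind₁ {σ τ : Type*} {a : σ → MvPolynomial τ ℂ} {p : MvPolynomial σ ℂ} {e k : ℕ}
    (hp : p.IsHomogeneous k) (ha : ∀ i, (a i).IsHomogeneous e) :
    (bind₁ a p).IsHomogeneous (e * k) := by
  rw [← aeval_eq_bind₁]
  exact hp.aeval a ha

/-- The Nullstellensatz for a hypersurface with irreducible equation. -/
lemma dvd_of_eval_eq_zero {σ : Type*} [Finite σ] {F B : MvPolynomial σ ℂ} (hF : Irreducible F)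
    (h : ∀ v, eval v F = 0 → eval v B = 0) : F ∣ B := by
  have hp : (Ideal.span {F}).IsPrime :=
    (Ideal.span_singleton_prime hF.ne_zero).2 hF.prime
  rw [← Ideal.mem_span_singleton, ← IsPrime.vanishingIdeal_zeroLocus (K := ℂ) (Ideal.span {F})]
  intro v hv
  have := hv F (Ideal.mem_span_singleton_self F)
  rw [aeval_eq_eval] at this ⊢
  exact h v this

lemma exists_eval_ne_zero {σ : Type*} [Finite σ] {F B : MvPolynomial σ ℂ} (hF : Irreducible F)
    (h : ¬ F ∣ B) : ∃ v, eval v F = 0 ∧ eval v B ≠ 0 := by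
  by_contra! hc
  exact h (dvd_of_eval_eq_zero hF hc)

lemma eval_smul_of_isHomogeneous {σ : Type*} {H : MvPolynomial σ ℂ} {n : ℕ}
    (hH : H.IsHomogeneous n) (c : ℂ) (v : σ → ℂ) : eval (c • v) H = c ^ n * eval v H := by
  simp only [eval_eq, Finset.mul_sum]
  refine Finset.sum_congr rfl fun d hd => ?_
  have hdeg : ∑ i ∈ d.support, d i = n := (hH.degree_eq_sum_deg_support hd).symm
  simp only [Pi.smul_apply, smul_eq_mul, mul_pow, Finset.prod_mul_distrib,
    Finset.prod_pow_eq_pow_sum, hdeg]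
  ring

/-- The substitution `X i ↦ T • X i`, which records the homogeneous components of a polynomial as
the coefficients of a polynomial in `T`. -/
noncomputable def scaleHom (σ : Type*) : MvPolynomial σ ℂ →ₐ[ℂ] Polynomial (MvPolynomial σ ℂ) :=
  aeval fun i => Polynomial.monomial 1 (X i)

lemma coeff_scaleHom {σ : Type*} (p : MvPolynomial σ ℂ) (k : ℕ) :
    (scaleHom σ p).coeff k = homogeneousComponent k p := by
  induction p using MvPolynomial.induction_on' with
  | monomial d c =>
    have h : scaleHom σ (monomial d c) = Polynomial.monomial d.degree (monomial d c) := by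
      rw [scaleHom, aeval_monomial, Finsupp.prod]
      simp only [Polynomial.monomial_pow, one_mul]
      simp only [← Polynomial.C_mul_X_pow_eq_monomial, Finset.prod_mul_distrib,
        Finset.prod_pow_eq_pow_sum, ← map_prod]
      rw [monomial_eq, Finsupp.prod, map_mul, mul_assoc]
      rfl
    rw [h, Polynomial.coeff_monomial, homogeneousComponent_of_mem
      (isHomogeneous_monomial (n := d.degree) c rfl)]
    simp only [eq_comm]
  | add p q hp hq => simp [hp, hq]

/-- A factor of a nonzero form is a form: in `scaleHom`, the image of a form is a monomial. -/
lemma isHomogeneous_of_mul {σ : Type*} {A B : MvPolynomial σ ℂ} {n : ℕ}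
    (h : (A * B).IsHomogeneous n) (h0 : A * B ≠ 0) : ∃ k, A.IsHomogeneous k := by
  have hm : scaleHom σ A * scaleHom σ B = Polynomial.monomial n (A * B) := by
    rw [← map_mul]
    ext1 k
    rw [coeff_scaleHom, homogeneousComponent_of_mem h, Polynomial.coeff_monomial]
    simp only [eq_comm]
  have hne : scaleHom σ A * scaleHom σ B ≠ 0 := by
    rw [hm]; simpa using h0
  have hA := left_ne_zero_of_mul hne
  have hB := right_ne_zero_of_mul hne
  have h1 := Polynomial.natDegree_mul hA hB
  have h2 := Polynomial.natTrailingDegree_mul hA hB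
  rw [hm, Polynomial.natDegree_monomial_eq _ h0] at h1
  rw [hm, Polynomial.natTrailingDegree_monomial h0] at h2
  have h3 := Polynomial.natTrailingDegree_le_natDegree (scaleHom σ A)
  have h4 := Polynomial.natTrailingDegree_le_natDegree (scaleHom σ B)
  obtain ⟨N, hN⟩ : ∃ N, N = (scaleHom σ A).natDegree := ⟨_, rfl⟩
  rw [← hN] at h1 h3
  refine ⟨N, ?_⟩
  rw [← sum_homogeneousComponent A]
  refine IsHomogeneous.sum _ _ _ fun i _ => ?_
  by_cases hi : i = N
  · rw [← hi]; exact homogeneousComponent_isHomogeneous _ _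
  · rw [← coeff_scaleHom]
    rcases lt_or_gt_of_ne hi with hi | hi
    · rw [Polynomial.coeff_eq_zero_of_lt_natTrailingDegree (by omega)]
      exact isHomogeneous_zero _ _ _
    · rw [Polynomial.coeff_eq_zero_of_natDegree_lt (by omega)]
      exact isHomogeneous_zero _ _ _

/-- The coordinate ring of a plane projective curve has transcendence degree at most two. -/
lemma exists_algebraic_relation {F : Form} (hF : Irreducible F) (a : Fin 3 → Form) :
    ∃ p : MvPolynomial (Fin 3) ℂ, p ≠ 0 ∧ F ∣ bind₁ a p := by
  have hprime : (Ideal.span {F}).IsPrime := (Ideal.span_singleton_prime hF.ne_zero).2 hF.prime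
  let A := Form ⧸ Ideal.span {F}
  let π : Form →ₐ[ℂ] A := Ideal.Quotient.mkₐ ℂ _
  have hπ : ∀ p, π p = 0 ↔ F ∣ p := fun p => by
    rw [← Ideal.mem_span_singleton]; exact Ideal.Quotient.eq_zero_iff_mem
  by_contra! hc
  have ha : AlgebraicIndependent ℂ fun i => π (a i) := by
    rw [algebraicIndependent_iff]
    intro p hp
    by_contra h0
    refine hc p h0 ((hπ _).1 ?_)
    rw [← hp, ← aeval_eq_bind₁, ← AlgHom.comp_apply, comp_aeval]
  have hle := ha.lift_cardinalMk_le_trdeg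
  have htop : Algebra.adjoin ℂ (Set.range fun i => π (X i)) = ⊤ := by
    have : (Set.range fun i => π (X i)) = π '' Set.range (X : Fin 3 → Form) := by
      rw [← Set.range_comp]; rfl
    rw [this, ← AlgHom.map_adjoin, adjoin_range_X, Algebra.map_top]
    exact AlgHom.range_eq_top _ |>.2 Ideal.Quotient.mk_surjective
  have : Algebra.IsAlgebraic (Algebra.adjoin ℂ (Set.range fun i => π (X i))) A :=
    ⟨fun x => isAlgebraic_algebraMap
      (⟨x, htop ▸ Algebra.mem_top⟩ : Algebra.adjoin ℂ (Set.range fun i => π (X i)))⟩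
  have hb := Algebra.IsAlgebraic.isTranscendenceBasis_of_lift_le_trdeg_of_finite ℂ
    (fun i => π (X i)) hle
  refine hF.ne_zero (algebraicIndependent_iff.1 hb.1 F ?_)
  rw [← comp_aeval, AlgHom.comp_apply, aeval_X_left_apply]
  exact (hπ F).2 dvd_rfl

lemma homogeneousComponent_bind₁ {σ τ : Type*} {a : σ → MvPolynomial τ ℂ} {e : ℕ}
    (ha : ∀ i, (a i).IsHomogeneous e) (he : e ≠ 0) (r : MvPolynomial σ ℂ) (n : ℕ) :
    homogeneousComponent (e * n) (bind₁ a r) = bind₁ a (homogeneousComponent n r) := by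
  conv_lhs => rw [← sum_homogeneousComponent r, map_sum, map_sum]
  have : ∀ i, homogeneousComponent (e * n) (bind₁ a (homogeneousComponent i r)) =
      if i = n then bind₁ a (homogeneousComponent n r) else 0 := by
    intro i
    rw [homogeneousComponent_of_mem
      (isHomogeneous_bind₁ (homogeneousComponent_isHomogeneous i r) ha)]
    by_cases hi : i = n
    · simp [hi]
    · have hi' : ¬ e * n = e * i := fun hc => hi (Nat.eq_of_mul_eq_mul_left
        (Nat.pos_of_ne_zero he) hc).symm
      simp [hi, hi']
  simp only [this, Finset.sum_ite_eq', Finset.mem_range]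
  split_ifs with hlt
  · rfl
  · rw [homogeneousComponent_eq_zero _ _ (by omega), map_zero]

/-- Elimination: if `F` is irreducible and does not divide `h`, some nonzero binary form in `a, b`
lies in the ideal `(F, h)`. -/
lemma exists_eliminant {F h a b : Form} {d k e : ℕ} (hF : Irreducible F) (hFd : F.IsHomogeneous d)
    (hk : h.IsHomogeneous k) (hFh : ¬ F ∣ h) (ha : a.IsHomogeneous e) (hb : b.IsHomogeneous e)
    (he : e ≠ 0) : ∃ (r : MvPolynomial (Fin 2) ℂ) (n : ℕ), r ≠ 0 ∧ r.IsHomogeneous n ∧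
      bind₁ ![a, b] r ∈ Ideal.span {F, h} := by
  obtain ⟨p, hp0, hp⟩ := exists_algebraic_relation hF ![h, a, b]
  let θ : Polynomial (MvPolynomial (Fin 2) ℂ) →+* Form :=
    Polynomial.eval₂RingHom (bind₁ ![a, b]).toRingHom h
  have hθ : bind₁ ![h, a, b] p = θ (finSuccEquiv ℂ 2 p) := by
    have : (bind₁ ![h, a, b]).toRingHom = θ.comp (finSuccEquiv ℂ 2).toRingEquiv.toRingHom := by
      refine MvPolynomial.ringHom_ext (fun c => ?_) fun i => ?_
      · simp [θ, finSuccEquiv_apply]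
      · fin_cases i
        · simp [θ, finSuccEquiv_apply]
        · have := finSuccEquiv_X_succ (R := ℂ) (j := (0 : Fin 2))
          rw [Fin.succ_zero_eq_one] at this
          simp [θ, this]
        · have := finSuccEquiv_X_succ (R := ℂ) (j := (1 : Fin 2))
          rw [Fin.succ_one_eq_two] at this
          simp [θ, this]
    exact congrArg (fun f => f p) this
  set q := finSuccEquiv ℂ 2 p with hq
  have hq0 : q ≠ 0 := by simpa [hq] using hp0
  -- Dividing the relation by a power of `h`, its constant term becomes nonzero.
  obtain ⟨q', hq', hX⟩ := Polynomial.exists_eq_pow_rootMultiplicity_mul_and_not_dvd q hq0 0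
  rw [Polynomial.C_0, sub_zero] at hq' hX
  rw [Polynomial.X_dvd_iff] at hX
  have hFq' : F ∣ θ q' := by
    rw [hθ, hq', map_mul, map_pow] at hp
    refine (hF.prime.dvd_or_dvd hp).resolve_left fun hc => hFh ?_
    simpa [θ] using hF.prime.dvd_of_dvd_pow hc
  set r := q'.coeff 0 with hr
  have hmem : bind₁ ![a, b] r ∈ Ideal.span {F, h} := by
    have hdec : θ q' = h * θ q'.divX + bind₁ ![a, b] r := by
      have hsplit := congrArg θ (Polynomial.X_mul_divX_add q')
      rw [map_add, map_mul, show θ Polynomial.X = h by simp [θ],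
        show θ (Polynomial.C (q'.coeff 0)) = bind₁ ![a, b] r by simp [θ, hr]] at hsplit
      exact hsplit.symm
    have : bind₁ ![a, b] r = θ q' - h * θ q'.divX := by rw [hdec]; ring
    rw [this]
    refine Ideal.sub_mem _ (Ideal.mem_of_dvd _ hFq' (Ideal.subset_span (by simp))) ?_
    exact Ideal.mul_mem_right _ _ (Ideal.subset_span (by simp))
  obtain ⟨n, hn⟩ : ∃ n, homogeneousComponent n r ≠ 0 := by
    by_contra! hc
    exact hX (by rw [← sum_homogeneousComponent r]; simp [hc])
  refine ⟨homogeneousComponent n r, n, hn, homogeneousComponent_isHomogeneous _ _, ?_⟩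
  have hab : ∀ i, (![a, b] i).IsHomogeneous e := by
    intro i; fin_cases i <;> assumption
  rw [← homogeneousComponent_bind₁ hab he]
  let _ := MvPolynomial.gradedAlgebra (σ := Fin 3) (R := ℂ)
  refine homogeneousComponent_mem_of_mem (Ideal.homogeneous_span _ _ ?_) hmem _
  rintro x (rfl | rfl)
  exacts [⟨d, hFd⟩, ⟨k, hk⟩]

/-- The zeros of a nonzero binary form have finitely many ratios of coordinates. -/
lemma finite_binary_zeros {r : MvPolynomial (Fin 2) ℂ} {n : ℕ} (h0 : r ≠ 0)
    (hr : r.IsHomogeneous n) : {t : ℂ | eval ![t, 1] r = 0}.Finite := by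
  have hf : ∀ t : ℂ, (aeval ![Polynomial.X, 1] r : Polynomial ℂ).eval t = eval ![t, 1] r := by
    intro t
    have : (Polynomial.evalRingHom t).comp
        (aeval ![Polynomial.X, 1] : _ →ₐ[ℂ] Polynomial ℂ).toRingHom = eval ![t, 1] := by
      refine MvPolynomial.ringHom_ext (fun c => ?_) fun i => ?_
      · simp
      · fin_cases i <;> simp
    exact congrArg (fun f => f r) this
  have hne : (aeval ![Polynomial.X, 1] r : Polynomial ℂ) ≠ 0 := by
    intro hz
    have : r * X 1 = 0 := by
      refine MvPolynomial.funext fun v => ?_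
      rw [map_mul, eval_X, map_zero]
      by_cases hv : v 1 = 0
      · rw [hv, mul_zero]
      · have hv' : v = v 1 • ![v 0 / v 1, 1] := by
          ext i; fin_cases i <;> simp [mul_div_cancel₀ _ hv]
        have := hf (v 0 / v 1)
        rw [hz, Polynomial.eval_zero] at this
        rw [hv', eval_smul_of_isHomogeneous hr, ← this]
        simp
    exact h0 ((mul_eq_zero.1 this).resolve_right (X_ne_zero _))
  refine (Polynomial.finite_setOfPred_isRoot hne).subset fun t ht => ?_
  rw [Set.mem_ofPred_eq, Polynomial.IsRoot.def, hf]
  exact ht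

/-- A weak form of Bézout's theorem. -/
lemma finite_inter {F h : Form} {d k : ℕ} (hF : Irreducible F) (hFd : F.IsHomogeneous d)
    (hk : h.IsHomogeneous k) (hFh : ¬ F ∣ h) :
    {P : Plane | eval P.rep F = 0 ∧ eval P.rep h = 0}.Finite := by
  have key : ∀ i j : Fin 3, ∃ Z : Set ℂ, Z.Finite ∧ ∀ v : Vec, eval v F = 0 → eval v h = 0 →
      v j ≠ 0 → v i / v j ∈ Z := by
    intro i j
    obtain ⟨r, n, h0, hr, hmem⟩ := exists_eliminant hF hFd hk hFh (isHomogeneous_X ℂ i)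
      (isHomogeneous_X ℂ j) one_ne_zero
    refine ⟨_, finite_binary_zeros h0 hr, fun v hv hv' hj => ?_⟩
    obtain ⟨A, B, hAB⟩ := Ideal.mem_span_pair.1 hmem
    have h1 := congrArg (eval v) hAB
    rw [map_add, map_mul, map_mul, hv, hv', eval_bind₁] at h1
    have h2 : (fun l => eval v (![X i, X j] l)) = v j • ![v i / v j, 1] := by
      ext l; fin_cases l <;> simp [mul_div_cancel₀ _ hj]
    rw [h2, eval_smul_of_isHomogeneous hr] at h1
    have h3 : v j ^ n ≠ 0 := pow_ne_zero _ hj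
    simpa [h3] using h1.symm
  choose Z hZ hmem using key
  have hfin : ∀ j : Fin 3,
      {P : Plane | (eval P.rep F = 0 ∧ eval P.rep h = 0) ∧ P.rep j ≠ 0}.Finite := by
    intro j
    refine Set.Finite.of_finite_image (f := fun P : Plane => fun i => P.rep i / P.rep j)
      ((Set.Finite.pi (fun i => hZ i j)).subset ?_) ?_
    · rintro _ ⟨P, ⟨⟨h1, h2⟩, h3⟩, rfl⟩ i _
      exact hmem i j _ h1 h2 h3
    · rintro P ⟨_, hP⟩ R ⟨_, hR⟩ hPR
      rw [← P.mk_rep, ← R.mk_rep, Projectivization.mk_eq_mk_iff']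
      refine ⟨P.rep j / R.rep j, funext fun i => ?_⟩
      have := congrFun hPR i
      simp only [Pi.smul_apply, smul_eq_mul] at this ⊢
      field_simp at this ⊢
      rw [this]
  refine (Set.finite_iUnion hfin).subset fun P hP => ?_
  obtain ⟨j, hj⟩ := Function.ne_iff.1 P.rep_nonzero
  exact Set.mem_iUnion.2 ⟨j, hP, hj⟩

/-! ### The image of a plane curve under a rational map -/

/-- The value at `v` of a vector of forms. -/
noncomputable def evalVec (Ψ : Fin 3 → Form) (v : Vec) : Vec := fun i => eval v (Ψ i)

lemma exists_smul_eq_of_cross_eq_zero {a b : Vec} (ha : a ≠ 0) (h : a ⨯₃ b = 0) :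
    ∃ c : ℂ, c • a = b := by
  by_contra! hc
  exact crossProduct_ne_zero_iff_linearIndependent.2 ((LinearIndependent.pair_iff' ha).2 hc) h

lemma smul_cross_self (c : ℂ) (a : Vec) : a ⨯₃ (c • a) = 0 := by
  rw [map_smul, cross_self, smul_zero]

lemma mk_eq_mk_of_cross_eq_zero {a b : Vec} (ha : a ≠ 0) (hb : b ≠ 0) (h : a ⨯₃ b = 0) :
    Projectivization.mk ℂ a ha = Projectivization.mk ℂ b hb := by
  obtain ⟨c, hc⟩ := exists_smul_eq_of_cross_eq_zero ha h
  exact ((Projectivization.mk_eq_mk_iff' ℂ _ _ _ _).2 ⟨c, hc⟩).symm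

lemma rep_mk_eq_smul {a : Vec} (ha : a ≠ 0) :
    ∃ c : ℂ, c ≠ 0 ∧ (Projectivization.mk ℂ a ha).rep = c • a := by
  obtain ⟨c, hc⟩ := Projectivization.exists_smul_eq_mk_rep ℂ a ha
  exact ⟨c, c.ne_zero, hc.symm⟩

lemma mk_mem_zeroLocus {G : Form} {n : ℕ} (hG : G.IsHomogeneous n) {a : Vec} (ha : a ≠ 0) :
    Projectivization.mk ℂ a ha ∈ zeroLocus G ↔ eval a G = 0 := by
  obtain ⟨c, hc, h⟩ := rep_mk_eq_smul ha
  rw [zeroLocus, Set.mem_ofPred_eq, h, eval_smul_of_isHomogeneous hG]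
  simp [hc]

/-- The equation of the image of an irreducible plane curve `V(F)` under the rational map `Ψ`:
either `Ψ` is constant on the curve, or the forms vanishing on the image are the multiples of an
irreducible one. The forms vanishing on the image generate a nonzero prime ideal; if it contains two
coprime forms, the image is finite, hence a point. -/
lemma constant_or_exists_image_equation {F : Form} {d e : ℕ} {Ψ : Fin 3 → Form}
    (hF : Irreducible F) (hFd : F.IsHomogeneous d) (hΨ : ∀ i, (Ψ i).IsHomogeneous e) (he : e ≠ 0)
    (h0 : ∃ i, ¬ F ∣ Ψ i) :
    (∃ Q : Vec, Q ≠ 0 ∧ ∀ v, eval v F = 0 → Q ⨯₃ evalVec Ψ v = 0) ∨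
    ∃ (G : Form) (n : ℕ), G.IsHomogeneous n ∧ Irreducible G ∧ F ∣ bind₁ Ψ G ∧
      ∀ (H : Form) (k : ℕ), H.IsHomogeneous k → F ∣ bind₁ Ψ H → G ∣ H := by
  obtain ⟨p, hp0, hp⟩ := exists_algebraic_relation hF Ψ
  obtain ⟨n, hn⟩ : ∃ n, homogeneousComponent n p ≠ 0 := by
    by_contra! hc
    exact hp0 (by rw [← sum_homogeneousComponent p]; simp [hc])
  have hpn : F ∣ bind₁ Ψ (homogeneousComponent n p) := by
    rw [← homogeneousComponent_bind₁ hΨ he, ← Ideal.mem_span_singleton]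
    let _ := MvPolynomial.gradedAlgebra (σ := Fin 3) (R := ℂ)
    refine homogeneousComponent_mem_of_mem (Ideal.homogeneous_span _ _ ?_)
      (Ideal.mem_span_singleton.2 hp) _
    rintro x rfl
    exact ⟨d, hFd⟩
  obtain ⟨f, hf, hfp⟩ := UniqueFactorizationMonoid.exists_prime_factors _ hn
  obtain ⟨G, hGf, hFG⟩ : ∃ G ∈ f, F ∣ bind₁ Ψ G := by
    refine hF.prime.exists_mem_multiset_map_dvd ?_
    rw [← map_multiset_prod]
    exact hpn.trans (map_dvd (bind₁ Ψ) hfp.symm.dvd)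
  obtain ⟨A, hA⟩ := (Multiset.dvd_prod hGf).trans hfp.dvd
  obtain ⟨k, hk⟩ := isHomogeneous_of_mul (hA ▸ homogeneousComponent_isHomogeneous n p) (hA ▸ hn)
  have hG := (hf G hGf).irreducible
  by_cases hall : ∀ (H : Form) (k : ℕ), H.IsHomogeneous k → F ∣ bind₁ Ψ H → G ∣ H
  · exact Or.inr ⟨G, k, hk, hG, hFG, hall⟩
  left
  push Not at hall
  obtain ⟨H, l, hHl, hFH, hGH⟩ := hall
  have hfin := finite_inter hG hk hHl hGH
  obtain ⟨i, hi⟩ := h0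
  by_contra! hc
  have hcomp : ∀ P : Plane, ∃ c : Form, ¬ F ∣ c ∧ ∀ v, P.rep ⨯₃ evalVec Ψ v = 0 → eval v c = 0 := by
    intro P
    obtain ⟨v, hv, hne⟩ := hc P.rep P.rep_nonzero
    obtain ⟨j, hj⟩ := Function.ne_iff.1 hne
    have hev : ∀ w, eval w (((fun i => C (P.rep i)) ⨯₃ Ψ) j) = (P.rep ⨯₃ evalVec Ψ w) j := by
      intro w
      fin_cases j <;> simp [cross_apply, evalVec]
    refine ⟨((fun i => C (P.rep i)) ⨯₃ Ψ) j, ?_, fun w hw => by rw [hev, hw]; rfl⟩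
    rintro ⟨K, hK⟩
    apply hj
    rw [← hev, hK, map_mul, hv, zero_mul]
    rfl
  choose c hcF hc0 using hcomp
  obtain ⟨v, hv, hne⟩ := exists_eval_ne_zero hF (B := Ψ i * ∏ P ∈ hfin.toFinset, c P) fun hdvd => by
    rcases hF.prime.dvd_or_dvd hdvd with h | h
    · exact hi h
    · obtain ⟨P, _, hP⟩ := hF.prime.exists_mem_finset_dvd h
      exact hcF P hP
  rw [map_mul, map_prod] at hne
  have hΨv : evalVec Ψ v ≠ 0 := fun hz => left_ne_zero_of_mul hne (congrFun hz i)
  have hvan : ∀ K : Form, F ∣ bind₁ Ψ K → eval (evalVec Ψ v) K = 0 := by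
    rintro K ⟨M, hM⟩
    have := congrArg (eval v) hM
    rwa [eval_bind₁, map_mul, hv, zero_mul] at this
  have hmem : Projectivization.mk ℂ _ hΨv ∈ hfin.toFinset := by
    rw [Set.Finite.mem_toFinset]
    exact ⟨(mk_mem_zeroLocus hk hΨv).2 (hvan G hFG), (mk_mem_zeroLocus hHl hΨv).2 (hvan H hFH)⟩
  refine Finset.prod_ne_zero_iff.1 (right_ne_zero_of_mul hne) _ hmem (hc0 _ _ ?_)
  obtain ⟨a, _, ha⟩ := rep_mk_eq_smul hΨv
  rw [ha, map_smul, LinearMap.smul_apply, cross_self, smul_zero]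

/-! ### The reflected line -/

lemma dot_eq_add (v w : Vec) : v ⬝ᵥ w = v 0 * w 0 + v 1 * w 1 + v 2 * w 2 := by
  rw [dotProduct, Fin.sum_univ_three]

lemma dot_grad_self {H : Form} {n : ℕ} (hH : H.IsHomogeneous n) (v : Vec) :
    grad H v ⬝ᵥ v = n * eval v H := by
  have := congrArg (eval v) hH.sum_X_mul_pderiv
  simp only [map_sum, map_mul, eval_X, nsmul_eq_mul, map_natCast] at this
  rw [← this]
  exact Finset.sum_congr rfl fun i _ => mul_comm _ _

/-- The forms `(u, v, w)` whose values are the coordinates of the reflected line. -/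
noncomputable def reflForms (F : Form) (S : Vec) : Fin 3 → Form :=
  let Q := pderiv 0 F ^ 2 + pderiv 1 F ^ 2
  let D := C (S 0) * pderiv 0 F + C (S 1) * pderiv 1 F + C (S 2) * pderiv 2 F
  ![(C (S 2) * X 1 - X 2 * C (S 1)) * Q + 2 * X 2 * D * pderiv 1 F,
    (X 2 * C (S 0) - C (S 2) * X 0) * Q - 2 * X 2 * D * pderiv 0 F,
    (X 0 * C (S 1) - X 1 * C (S 0)) * Q - 2 * D * (X 0 * pderiv 1 F - X 1 * pderiv 0 F)]

lemma evalVec_reflForms (F : Form) (S m : Vec) :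
    evalVec (reflForms F S) m = reflectedVec F S m := by
  ext i
  fin_cases i <;>
    simp [evalVec, reflForms, reflectedVec, grad, dot_eq_add]

lemma isHomogeneous_reflForms {F : Form} {d : ℕ} (hd : 2 ≤ d) (hF : F.IsHomogeneous d) (S : Vec)
    (i : Fin 3) : (reflForms F S i).IsHomogeneous (2 * d - 1) := by
  have h2 : ∀ {n : ℕ} {p : Form}, p.IsHomogeneous n → (2 * p).IsHomogeneous n := fun h => by
    rw [two_mul]; exact h.add h
  have hp : ∀ i, (pderiv i F).IsHomogeneous (d - 1) := fun i => hF.pderiv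
  have hC : ∀ i j, (C (S i) * X j : Form).IsHomogeneous 1 := fun i j =>
    (isHomogeneous_X ℂ j).C_mul _
  have hC' : ∀ i j, (X j * C (S i) : Form).IsHomogeneous 1 := fun i j => by
    rw [mul_comm]; exact hC i j
  have hQ : (pderiv 0 F ^ 2 + pderiv 1 F ^ 2).IsHomogeneous ((d - 1) * 2) :=
    ((hp 0).pow 2).add ((hp 1).pow 2)
  have hD : (C (S 0) * pderiv 0 F + C (S 1) * pderiv 1 F + C (S 2) * pderiv 2 F).IsHomogeneous
    (d - 1) := (((hp 0).C_mul _).add ((hp 1).C_mul _)).add ((hp 2).C_mul _)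
  have e1 : 1 + (d - 1) * 2 = 2 * d - 1 := by omega
  have e2 : 1 + (d - 1) + (d - 1) = 2 * d - 1 := by omega
  have e3 : d - 1 + (1 + (d - 1)) = 2 * d - 1 := by omega
  fin_cases i
  · exact (e1 ▸ ((hC 2 1).sub (hC' 1 2)).mul hQ).add
      (e2 ▸ ((h2 (isHomogeneous_X ℂ 2)).mul hD).mul (hp 1))
  · exact (e1 ▸ ((hC' 0 2).sub (hC 2 0)).mul hQ).sub
      (e2 ▸ ((h2 (isHomogeneous_X ℂ 2)).mul hD).mul (hp 0))
  · exact (e1 ▸ ((hC' 1 0).sub (hC' 0 1)).mul hQ).sub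
      (e3 ▸ (h2 hD).mul (((isHomogeneous_X ℂ 0).mul (hp 1)).sub ((isHomogeneous_X ℂ 1).mul (hp 0))))

lemma reflectedVec_dot (F : Form) (S m : Vec) : reflectedVec F S m ⬝ᵥ m = 0 := by
  rw [dot_eq_add]
  simp only [reflectedVec, Matrix.cons_val]
  ring

/-- The incident line at a mirror point is not the line at infinity. -/
lemma incident_ne {F : Form} {S m : Vec} (hS : S ≠ 0) (hm : IsMirrorPoint F S m) :
    (m ⨯₃ S) 0 ≠ 0 ∨ (m ⨯₃ S) 1 ≠ 0 := by
  by_contra! h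
  have h2 : (m ⨯₃ S) 2 = 0 := by
    have := dot_self_cross m S
    rw [dot_eq_add, h.1, h.2] at this
    simpa [hm.2.2.1] using this
  have h0 : S ⨯₃ m = 0 := by
    rw [← cross_anticomm, neg_eq_zero]
    ext i; fin_cases i <;> simp [h.1, h.2, h2]
  obtain ⟨c, hc⟩ := exists_smul_eq_of_cross_eq_zero hS h0
  exact hm.2.1 c hc.symm

/-- The Snell-Descartes law in polynomial form. The linear forms `l₀ ± i l₁` vanish on the lines
through the cyclic points. -/
lemma crossRatio_eq_iff {v g l : Vec} (hv : v 0 ≠ 0 ∨ v 1 ≠ 0) (hg : g 0 ^ 2 + g 1 ^ 2 ≠ 0)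
    (hl : l 0 ≠ 0 ∨ l 1 ≠ 0) :
    crossRatio (pointAtInfinity v) (pointAtInfinity g) cyclicI cyclicJ =
      crossRatio (pointAtInfinity g) (pointAtInfinity l) cyclicI cyclicJ ↔
    (v 0 + Complex.I * v 1) * (l 0 + Complex.I * l 1) * (g 0 - Complex.I * g 1) ^ 2 =
      (g 0 + Complex.I * g 1) ^ 2 * (l 0 - Complex.I * l 1) * (v 0 - Complex.I * v 1) := by
  have hI := Complex.I_mul_I
  have hzero : ∀ w : Vec, (w 0 ≠ 0 ∨ w 1 ≠ 0) → w 0 - Complex.I * w 1 = 0 →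
      w 0 + Complex.I * w 1 ≠ 0 := by
    intro w hw h1 h2
    have h3 : w 0 = 0 := by linear_combination (h1 + h2) / 2
    have h4 : w 1 = 0 := by linear_combination (-Complex.I / 2) * (h2 - h1) + w 1 * hI
    tauto
  have hgg : (g 0 + Complex.I * g 1) * (g 0 - Complex.I * g 1) ≠ 0 := by
    intro h; apply hg; linear_combination h + g 1 ^ 2 * hI
  have hgp := left_ne_zero_of_mul hgg
  have hgq := right_ne_zero_of_mul hgg
  have key : ∀ a b : Vec, crossRatio (pointAtInfinity a) (pointAtInfinity b) cyclicI cyclicJ =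
      open Classical in if (b 0 + Complex.I * b 1) * (a 0 - Complex.I * a 1) = 0 then OnePoint.infty
      else (((a 0 + Complex.I * a 1) * (b 0 - Complex.I * b 1) /
        ((b 0 + Complex.I * b 1) * (a 0 - Complex.I * a 1)) : ℂ) : OnePoint ℂ) := by
    intro a b
    have e1 : Complex.I * a 1 - -a 0 * 1 = a 0 + Complex.I * a 1 := by ring
    have e2 : Complex.I * b 1 - -b 0 * 1 = b 0 + Complex.I * b 1 := by ring
    have e3 : -Complex.I * a 1 - -a 0 * 1 = a 0 - Complex.I * a 1 := by ring
    have e4 : -Complex.I * b 1 - -b 0 * 1 = b 0 - Complex.I * b 1 := by ring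
    simp only [crossRatio, pointAtInfinity, cyclicI, cyclicJ, e1, e2, e3, e4]
  rw [key, key]
  by_cases hvq : v 0 - Complex.I * v 1 = 0
  · have := hzero v hv hvq
    rw [if_pos (by rw [hvq, mul_zero]), hvq, mul_zero]
    by_cases hlp : l 0 + Complex.I * l 1 = 0
    · simp [hlp]
    · simp [hlp, this, hgq]
  · by_cases hlp : l 0 + Complex.I * l 1 = 0
    · have hlq : l 0 - Complex.I * l 1 ≠ 0 := fun h => hzero l hl h hlp
      simp [hlp, hvq, hgp, hlq, eq_comm (a := (0 : ℂ))]
    · rw [if_neg (mul_ne_zero hgp hvq), if_neg (mul_ne_zero hlp hgq), OnePoint.coe_eq_coe,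
        div_eq_div_iff (mul_ne_zero hgp hvq) (mul_ne_zero hlp hgq)]
      constructor <;> intro h <;> linear_combination h

/-- By Euler's identity, `m ⬝ᵥ ∇F = 0` at a point `m` of the curve. -/
lemma incident_cross_grad {F : Form} {d : ℕ} (hF : F.IsHomogeneous d) {m : Vec} (S : Vec)
    (hm : eval m F = 0) :
    (m ⨯₃ S) 1 * grad F m 0 - (m ⨯₃ S) 0 * grad F m 1 = m 2 * (S ⬝ᵥ grad F m) := by
  have := dot_grad_self hF m
  rw [hm, mul_zero] at this
  rw [dot_eq_add] at this ⊢
  simp only [cross_apply, Matrix.cons_val]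
  linear_combination -S 2 * this

/-- Reflection exchanges the coordinates along the two isotropic directions, up to the square of the
tangent's. -/
lemma reflectedVec_isotropic {F : Form} {d : ℕ} (hF : F.IsHomogeneous d) {m : Vec} (S : Vec)
    (hm : eval m F = 0) :
    reflectedVec F S m 0 + Complex.I * reflectedVec F S m 1 =
      (grad F m 0 + Complex.I * grad F m 1) ^ 2 * ((m ⨯₃ S) 0 - Complex.I * (m ⨯₃ S) 1) ∧
    reflectedVec F S m 0 - Complex.I * reflectedVec F S m 1 =
      (grad F m 0 - Complex.I * grad F m 1) ^ 2 * ((m ⨯₃ S) 0 + Complex.I * (m ⨯₃ S) 1) := by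
  have h := incident_cross_grad hF S hm
  have hI := Complex.I_sq
  set v := m ⨯₃ S with hv
  set g := grad F m with hg
  have hv0 : v 0 = m 1 * S 2 - m 2 * S 1 := by simp [v, cross_apply]
  have hv1 : v 1 = m 2 * S 0 - m 0 * S 2 := by simp [v, cross_apply]
  have hl0 : reflectedVec F S m 0 =
      v 0 * (g 0 ^ 2 + g 1 ^ 2) + 2 * (v 1 * g 0 - v 0 * g 1) * g 1 := by
    rw [h, hv0]
    simp only [reflectedVec, Matrix.cons_val, ← hg]
    ring
  have hl1 : reflectedVec F S m 1 =
      v 1 * (g 0 ^ 2 + g 1 ^ 2) - 2 * (v 1 * g 0 - v 0 * g 1) * g 0 := by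
    rw [h, hv1]
    simp only [reflectedVec, Matrix.cons_val, ← hg]
    ring
  rw [hl0, hl1]
  constructor <;> ring_nf <;> simp only [hI, Complex.I_pow_three] <;> ring

lemma gradQ_eq_mul (F : Form) (m : Vec) : gradQ F m =
    (grad F m 0 + Complex.I * grad F m 1) * (grad F m 0 - Complex.I * grad F m 1) := by
  rw [gradQ]
  linear_combination grad F m 1 ^ 2 * Complex.I_sq

lemma reflectedVec_ne {F : Form} {d : ℕ} (hF : F.IsHomogeneous d) {S m : Vec} (hS : S ≠ 0)
    (hm : IsMirrorPoint F S m) : reflectedVec F S m 0 ≠ 0 ∨ reflectedVec F S m 1 ≠ 0 := by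
  by_contra! h
  obtain ⟨hp, hq⟩ := reflectedVec_isotropic hF S hm.1
  have hQ := hm.2.2.2
  rw [gradQ_eq_mul] at hQ
  rw [h.1, h.2, mul_zero, add_zero, zero_eq_mul,
    or_iff_right (pow_ne_zero _ (left_ne_zero_of_mul hQ))] at hp
  rw [h.1, h.2, mul_zero, sub_zero, zero_eq_mul,
    or_iff_right (pow_ne_zero _ (right_ne_zero_of_mul hQ))] at hq
  have h0 : (m ⨯₃ S) 0 = 0 := by linear_combination (hp + hq) / 2
  have h1 : (m ⨯₃ S) 1 = 0 := by
    linear_combination (-Complex.I / 2) * (hq - hp) + (m ⨯₃ S) 1 * Complex.I_sq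
  exact (incident_ne hS hm).elim (· h0) (· h1)

lemma line_ne {l m : Vec} (hl : l ≠ 0) (hm : m 2 ≠ 0) (hlm : l ⬝ᵥ m = 0) : l 0 ≠ 0 ∨ l 1 ≠ 0 := by
  by_contra! h
  rw [dot_eq_add, h.1, h.2] at hlm
  have : l 2 = 0 := by simpa [hm] using hlm
  exact hl (by ext i; fin_cases i <;> simp [h.1, h.2, this])

/-- The line with coordinates `reflectedVec` is the reflected line. -/
lemma isReflectedLine_reflectedVec {F : Form} {d : ℕ} (hF : F.IsHomogeneous d) {S m : Vec}
    (hS : S ≠ 0) (hm : IsMirrorPoint F S m) : IsReflectedLine F S m (reflectedVec F S m) := by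
  have hne := reflectedVec_ne hF hS hm
  refine ⟨fun h => by simp [h] at hne, reflectedVec_dot F S m, ?_⟩
  rw [crossRatio_eq_iff (incident_ne hS hm) hm.2.2.2 hne]
  obtain ⟨hp, hq⟩ := reflectedVec_isotropic hF S hm.1
  rw [hp, hq]
  ring

/-- There is only one reflected line: for a fixed tangent and a fixed incident line, the
Snell-Descartes law is a linear equation in the reflected one. -/
lemma IsReflectedLine.cross_eq_zero {F : Form} {d : ℕ} (hF : F.IsHomogeneous d) {S m l : Vec}
    (hS : S ≠ 0) (hm : IsMirrorPoint F S m) (hl : IsReflectedLine F S m l) :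
    reflectedVec F S m ⨯₃ l = 0 := by
  have hlaw := (crossRatio_eq_iff (incident_ne hS hm) hm.2.2.2
    (line_ne hl.1 hm.2.2.1 hl.2.1)).1 hl.2.2
  obtain ⟨hp, hq⟩ := reflectedVec_isotropic hF S hm.1
  have hlm := hl.2.1
  have hρm := reflectedVec_dot F S m
  rw [dot_eq_add] at hlm hρm
  have h2 : reflectedVec F S m 0 * l 1 - reflectedVec F S m 1 * l 0 = 0 := by
    set r := reflectedVec F S m
    have h : (r 0 - Complex.I * r 1) * (l 0 + Complex.I * l 1) =
        (r 0 + Complex.I * r 1) * (l 0 - Complex.I * l 1) := by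
      rw [hp, hq]; linear_combination hlaw
    linear_combination (-Complex.I / 2) * h +
      (r 0 * l 1 - r 1 * l 0) * Complex.I_sq
  have hz := hm.2.2.1
  have e0 : (reflectedVec F S m 1 * l 2 - reflectedVec F S m 2 * l 1) * m 2 = 0 := by
    linear_combination reflectedVec F S m 1 * hlm - l 1 * hρm + m 0 * h2
  have e1 : (reflectedVec F S m 2 * l 0 - reflectedVec F S m 0 * l 2) * m 2 = 0 := by
    linear_combination -reflectedVec F S m 0 * hlm + l 0 * hρm + m 1 * h2
  rw [mul_eq_zero, or_iff_left hz] at e0 e1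
  rw [cross_apply, e0, e1, h2]
  ext i; fin_cases i <;> rfl

/-! ### Differentiation along the curve -/

/-- The derivation `F_y ∂_x - F_x ∂_y`, tangent to the curves `F = const` in the affine planes
`z = const`. -/
noncomputable def tangentDeriv (F : Form) : Derivation ℂ Form Form :=
  pderiv 1 F • pderiv 0 - pderiv 0 F • pderiv 1

/-- The tangent vector `(F_y, -F_x, 0)` at `m`. -/
noncomputable def tangentVec (F : Form) (m : Vec) : Vec := ![grad F m 1, -grad F m 0, 0]

lemma tangentDeriv_apply (F H : Form) :
    tangentDeriv F H = pderiv 1 F * pderiv 0 H - pderiv 0 F * pderiv 1 H := rfl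

lemma eval_tangentDeriv (F H : Form) (m : Vec) :
    eval m (tangentDeriv F H) = grad H m ⬝ᵥ tangentVec F m := by
  rw [tangentDeriv_apply, dot_eq_add]
  simp [tangentVec, grad]
  ring

lemma isHomogeneous_tangentDeriv {F H : Form} {d n : ℕ} (hd : 2 ≤ d) (hn : n ≠ 0)
    (hF : F.IsHomogeneous d) (hH : H.IsHomogeneous n) :
    (tangentDeriv F H).IsHomogeneous (n + d - 2) := by
  have e : d - 1 + (n - 1) = n + d - 2 := by omega
  rw [tangentDeriv_apply, ← e]
  exact (hF.pderiv.mul hH.pderiv).sub (hF.pderiv.mul hH.pderiv)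

lemma dvd_tangentDeriv {F H : Form} (h : F ∣ H) : F ∣ tangentDeriv F H := by
  obtain ⟨K, rfl⟩ := h
  have : tangentDeriv F F = 0 := by rw [tangentDeriv_apply]; ring
  rw [Derivation.leibniz, this, smul_zero, add_zero]
  exact Dvd.intro _ rfl

lemma hasFDerivAt_eval (H : Form) (m : Vec) : HasFDerivAt (fun v : Vec => eval v H)
    (∑ i, grad H m i • ContinuousLinearMap.proj (R := ℂ) (φ := fun _ : Fin 3 => ℂ) i) m := by
  induction H using MvPolynomial.induction_on with
  | C c =>
    simp only [eval_C]
    refine (hasFDerivAt_const c m).congr_fderiv ?_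
    ext w
    simp [grad]
  | add p q hp hq =>
    simp only [map_add]
    refine (hp.fun_add hq).congr_fderiv ?_
    ext w
    simp [grad, add_mul, Finset.sum_add_distrib]
  | mul_X p j hp =>
    have hX : HasFDerivAt (fun v : Vec => v j)
      (ContinuousLinearMap.proj (R := ℂ) (φ := fun _ : Fin 3 => ℂ) j) m :=
      (ContinuousLinearMap.proj (R := ℂ) (φ := fun _ : Fin 3 => ℂ) j).hasFDerivAt
    have h := hp.mul hX
    simp only [map_mul, eval_X]
    refine h.congr_fderiv ?_
    ext w
    simp [grad, Fin.sum_univ_three, pderiv_X, Pi.single_apply]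
    fin_cases j <;> simp <;> ring

lemma hasDerivAt_eval {H : Form} {γ : ℂ → Vec} {w : Vec} {t : ℂ} (hγ : HasDerivAt γ w t) :
    HasDerivAt (fun s => eval (γ s) H) (grad H (γ t) ⬝ᵥ w) t := by
  have := (hasFDerivAt_eval H (γ t)).comp_hasDerivAt t hγ
  refine this.congr_deriv ?_
  simp [dotProduct]

/-- A vector annihilated by `∇F` at a point of the curve is a combination of the point and of the
tangent vector. -/
lemma exists_eq_smul_add_smul {F : Form} {d : ℕ} (hF : F.IsHomogeneous d) {m w : Vec}
    (hm : eval m F = 0) (hz : m 2 ≠ 0) (hQ : gradQ F m ≠ 0) (hw : grad F m ⬝ᵥ w = 0) :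
    ∃ a b : ℂ, w = a • m + b • tangentVec F m := by
  have he := dot_grad_self hF m
  rw [hm, mul_zero] at he
  rw [dot_eq_add] at he hw
  set g := grad F m with hg
  rw [gradQ, ← hg] at hQ
  have h : g 0 * (w 0 * m 2 - w 2 * m 0) + g 1 * (w 1 * m 2 - w 2 * m 1) = 0 := by
    linear_combination m 2 * hw - w 2 * he
  refine ⟨w 2 / m 2, (g 1 * (w 0 * m 2 - w 2 * m 0) - g 0 * (w 1 * m 2 - w 2 * m 1)) /
    (m 2 * (g 0 ^ 2 + g 1 ^ 2)), ?_⟩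
  ext i
  fin_cases i <;> simp [tangentVec, ← hg] <;> field_simp
  · linear_combination g 0 * h
  · linear_combination g 1 * h

/-- The vector of the derivatives `tangentDeriv F (Ψ i)`. -/
noncomputable def tangentDerivVec (F : Form) (Ψ : Fin 3 → Form) : Fin 3 → Form :=
  fun i => tangentDeriv F (Ψ i)

lemma hasDerivAt_evalVec {F : Form} {Ψ : Fin 3 → Form} {e : ℕ} (hΨ : ∀ i, (Ψ i).IsHomogeneous e)
    {γ : ℂ → Vec} {t a b : ℂ} (hγ : HasDerivAt γ (a • γ t + b • tangentVec F (γ t)) t) :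
    HasDerivAt (fun s => evalVec Ψ (γ s))
      ((a * e) • evalVec Ψ (γ t) + b • evalVec (tangentDerivVec F Ψ) (γ t)) t := by
  refine hasDerivAt_pi.2 fun i => (hasDerivAt_eval hγ).congr_deriv ?_
  rw [dotProduct_add, dotProduct_smul, dotProduct_smul, dot_grad_self (hΨ i),
    ← eval_tangentDeriv]
  simp [evalVec, tangentDerivVec]
  ring

lemma hasDerivAt_cross {f g : ℂ → Vec} {f' g' : Vec} {t : ℂ} (hf : HasDerivAt f f' t)
    (hg : HasDerivAt g g' t) :
    HasDerivAt (fun s => f s ⨯₃ g s) (f' ⨯₃ g t + f t ⨯₃ g') t := by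
  rw [hasDerivAt_pi] at hf hg ⊢
  have key : ∀ i j, HasDerivAt (fun s => f s i * g s j - f s j * g s i)
      ((f' i * g t j - f' j * g t i) + (f t i * g' j - f t j * g' i)) t := fun i j =>
    (((hf i).mul (hg j)).sub ((hf j).mul (hg i))).congr_deriv (by ring)
  intro i
  fin_cases i
  · simpa [cross_apply] using key 1 2
  · simpa [cross_apply] using key 2 0
  · simpa [cross_apply] using key 0 1

/-! ### Analytic arcs -/

/-- Near a point where `∇F` is not isotropic, the curve is parametrized by an analytic arc in the
plane `z = const`. It comes from the inverse function theorem for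
`v ↦ (F v, v₂, F_y(m) v₀ - F_x(m) v₁)`, whose Jacobian determinant at `m` is, up to sign,
`F_x² + F_y²`. -/
lemma exists_analytic_arc {F : Form} {m : Vec} (hm : eval m F = 0) (hQ : gradQ F m ≠ 0) :
    ∃ γ : ℂ → Vec, AnalyticAt ℂ γ 0 ∧ γ 0 = m ∧ (∀ᶠ t in 𝓝 (0 : ℂ), eval (γ t) F = 0) ∧
      (∀ᶠ t in 𝓝 (0 : ℂ), γ t 2 = m 2) ∧
      ∃ b : ℂ, b ≠ 0 ∧ HasDerivAt γ (b • tangentVec F m) 0 := by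
  set g := grad F m with hg
  rw [gradQ, ← hg] at hQ
  let Ξ : Vec → Vec := fun v => ![eval v F, v 2, g 1 * v 0 - g 0 * v 1]
  let P : Fin 3 → Vec →L[ℂ] ℂ := fun i => ContinuousLinearMap.proj (R := ℂ) (φ := fun _ => ℂ) i
  let L : Vec →L[ℂ] Vec := ContinuousLinearMap.pi
    ![∑ i, g i • P i, P 2, g 1 • P 0 - g 0 • P 1]
  have hL : Function.Injective L := by
    rw [injective_iff_map_eq_zero]
    intro w hw
    have h0 : g 0 * w 0 + g 1 * w 1 + g 2 * w 2 = 0 := by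
      simpa [L, P, Fin.sum_univ_three] using congrFun hw 0
    have h2 : w 2 = 0 := by simpa [L, P] using congrFun hw 1
    have h1 : g 1 * w 0 - g 0 * w 1 = 0 := by simpa [L, P] using congrFun hw 2
    have e0 : (g 0 ^ 2 + g 1 ^ 2) * w 0 = 0 := by
      linear_combination g 0 * h0 + g 1 * h1 - g 0 * g 2 * h2
    have e1 : (g 0 ^ 2 + g 1 ^ 2) * w 1 = 0 := by
      linear_combination g 1 * h0 - g 0 * h1 - g 1 * g 2 * h2
    rw [mul_eq_zero, or_iff_right hQ] at e0 e1
    ext i; fin_cases i <;> simp [e0, e1, h2]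
  let Le : Vec ≃L[ℂ] Vec :=
    (LinearEquiv.ofInjectiveEndo (L : Vec →ₗ[ℂ] Vec) hL).toContinuousLinearEquiv
  have hLe : (Le : Vec →L[ℂ] Vec) = L := by ext w; rfl
  have hΞ : HasFDerivAt Ξ (Le : Vec →L[ℂ] Vec) m := by
    rw [hLe, hasFDerivAt_pi']
    intro i
    fin_cases i
    · exact hasFDerivAt_eval F m
    · exact (P 2).hasFDerivAt
    · exact (g 1 • P 0 - g 0 • P 1).hasFDerivAt
  have han : ContDiffAt ℂ ⊤ Ξ m := by
    refine contDiffAt_pi.2 fun i => ?_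
    fin_cases i
    · exact (AnalyticOnNhd.eval_mvPolynomial F m (Set.mem_univ _)).contDiffAt
    · exact (P 2).contDiff.contDiffAt
    · exact (g 1 • P 0 - g 0 • P 1).contDiff.contDiffAt
  let inv := han.localInverse hΞ (by simp)
  let e₃ : Vec := ![0, 0, 1]
  let path : ℂ → Vec := fun t => Ξ m + t • e₃
  have hpath0 : path 0 = Ξ m := by simp only [path, zero_smul, add_zero]
  have hpath : ContDiffAt ℂ ⊤ path 0 := by
    apply ContDiff.contDiffAt
    fun_prop
  have hinv : ContDiffAt ℂ ⊤ inv (path 0) := by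
    rw [hpath0]; exact han.to_localInverse hΞ _
  have hγan : AnalyticAt ℂ (inv ∘ path) 0 := (hinv.comp 0 hpath).analyticAt
  have hright : ∀ᶠ t in 𝓝 (0 : ℂ), Ξ (inv (path t)) = path t := by
    have h1 := (han.hasStrictFDerivAt' hΞ (by simp)).eventually_right_inverse
    rw [← hpath0] at h1
    exact hpath.continuousAt.eventually h1
  have hγ0 : (inv ∘ path) 0 = m := by
    simp only [Function.comp, hpath0]; exact han.localInverse_apply_image hΞ _
  refine ⟨inv ∘ path, hγan, hγ0, ?_, ?_, ?_⟩
  · filter_upwards [hright] with t ht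
    simpa [Ξ, path, e₃, hm] using congrFun ht 0
  · filter_upwards [hright] with t ht
    simpa [Ξ, path, e₃] using congrFun ht 1
  · obtain ⟨w, hw⟩ : ∃ w, HasDerivAt (inv ∘ path) w 0 :=
      ⟨_, hγan.differentiableAt.hasDerivAt⟩
    have h1 : HasDerivAt (Ξ ∘ (inv ∘ path)) (L w) 0 := by
      rw [← hLe]
      exact HasFDerivAt.comp_hasDerivAt 0 (by rw [hγ0]; exact hΞ) hw
    have h2 : HasDerivAt path e₃ 0 := by
      refine (((hasDerivAt_id (0 : ℂ)).smul_const e₃).const_add (Ξ m)).congr_deriv ?_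
      rw [one_smul]
    have h3 : L w = e₃ := (h1.congr_of_eventuallyEq
      (hright.mono fun t ht => ht.symm)).unique h2
    have e0 : g 0 * w 0 + g 1 * w 1 + g 2 * w 2 = 0 := by
      simpa [e₃, L, P, Fin.sum_univ_three] using congrFun h3 0
    have e2 : w 2 = 0 := by simpa [e₃, L, P] using congrFun h3 1
    have e1 : g 1 * w 0 - g 0 * w 1 = 1 := by simpa [e₃, L, P] using congrFun h3 2
    refine ⟨(g 0 ^ 2 + g 1 ^ 2)⁻¹, inv_ne_zero hQ, hw.congr_deriv ?_⟩
    ext i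
    fin_cases i <;> simp [tangentVec, ← hg] <;> try field_simp
    · linear_combination g 0 * e0 + g 1 * e1 - g 0 * g 2 * e2
    · linear_combination g 1 * e0 - g 0 * e1 - g 1 * g 2 * e2
    · exact e2

/-- A form vanishing along an arc of an irreducible curve vanishes on the curve. -/
lemma dvd_of_eventually_eval_eq_zero {F B : Form} {d k : ℕ} (hF : Irreducible F)
    (hFd : F.IsHomogeneous d) (hB : B.IsHomogeneous k) {γ : ℂ → Vec} {w : Vec} {c : ℂ}
    (hγ : HasDerivAt γ w 0) (hw : w ≠ 0) (hc : c ≠ 0)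
    (hF0 : ∀ᶠ t in 𝓝 (0 : ℂ), eval (γ t) F = 0) (hz : ∀ᶠ t in 𝓝 (0 : ℂ), γ t 2 = c)
    (hB0 : ∀ᶠ t in 𝓝 (0 : ℂ), eval (γ t) B = 0) : F ∣ B := by
  by_contra hFB
  suffices hfin : {v : Vec | v 2 = c ∧ eval v F = 0 ∧ eval v B = 0}.Finite by
    -- `γ` takes finitely many values near `0`, so it is locally constant, being continuous.
    have hopen : IsOpen ({v : Vec | v 2 = c ∧ eval v F = 0 ∧ eval v B = 0} \ {γ 0})ᶜ :=
      (hfin.subset Set.sdiff_subset).isClosed.isOpen_compl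
    have h1 := hγ.continuousAt.eventually (hopen.mem_nhds (by simp))
    have h2 := hγ.eventually_ne (c := γ 0) hw
    have h3 := ((h1.and (hF0.and (hz.and hB0))).filter_mono nhdsWithin_le_nhds).and h2
    obtain ⟨t, ⟨h1, h2, h3, h4⟩, h5⟩ := h3.exists
    exact h1 ⟨⟨h3, h2, h4⟩, h5⟩
  refine ((finite_inter hF hFd hB hFB).image
    fun P : Plane => (c / P.rep 2) • P.rep).subset ?_
  rintro v ⟨hv, h1, h2⟩
  have hv0 : v ≠ 0 := by rintro rfl; exact hc hv.symm
  refine ⟨Projectivization.mk ℂ v hv0,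
    ⟨(mk_mem_zeroLocus hFd hv0).2 h1, (mk_mem_zeroLocus hB hv0).2 h2⟩, ?_⟩
  obtain ⟨a, ha, har⟩ := rep_mk_eq_smul hv0
  simp only [har]
  ext i
  simp [hv]
  field_simp

lemma continuous_gradQ (F : Form) : Continuous (gradQ F) := by
  unfold gradQ grad
  exact ((continuous_eval _).pow 2).add ((continuous_eval _).pow 2)

/-- A rational map on the curve whose derivative is everywhere proportional to it is constant. -/
lemma constant_of_cross_tangentDeriv_eq_zero {F : Form} {d e : ℕ} {Ψ : Fin 3 → Form}
    (hF : Irreducible F) (hFd : F.IsHomogeneous d) (hΨ : ∀ i, (Ψ i).IsHomogeneous e)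
    (h : ∀ v, eval v F = 0 → evalVec Ψ v ⨯₃ evalVec (tangentDerivVec F Ψ) v = 0) {m : Vec}
    (hm : eval m F = 0) (hz : m 2 ≠ 0) (hQ : gradQ F m ≠ 0) (hne : evalVec Ψ m ≠ 0) :
    ∃ Q : Vec, Q ≠ 0 ∧ ∀ v, eval v F = 0 → Q ⨯₃ evalVec Ψ v = 0 := by
  obtain ⟨γ, hγ, hγ0, hγF, hγz, b, hb, hγ'⟩ := exists_analytic_arc hm hQ
  obtain ⟨i, hi⟩ := Function.ne_iff.1 hne
  have hτ : tangentVec F m ≠ 0 := by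
    intro h0
    have h1 : grad F m 1 = 0 := by simpa [tangentVec] using congrFun h0 0
    have h2 : grad F m 0 = 0 := by simpa [tangentVec] using congrFun h0 1
    exact hQ (by simp [gradQ, h1, h2])
  let ψ : ℂ → Vec := fun t => evalVec Ψ (γ t)
  have hgradQ : ∀ᶠ t in 𝓝 (0 : ℂ), gradQ F (γ t) ≠ 0 :=
    ((continuous_gradQ F).continuousAt.comp hγ.continuousAt).eventually_ne
      (by simpa [hγ0] using hQ)
  have hψi : ∀ᶠ t in 𝓝 (0 : ℂ), ψ t i ≠ 0 := by
    have hc : ContinuousAt (fun t => ψ t i) 0 :=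
      (continuous_eval (Ψ i)).continuousAt.comp hγ.continuousAt
    exact hc.eventually_ne (by simpa [ψ, hγ0] using hi)
  -- On the arc, `ψ'` is proportional to `ψ`, so the ratios `ψ j / ψ i` have derivative zero.
  have hderiv : ∀ᶠ t in 𝓝 (0 : ℂ), ∀ j, HasDerivAt (fun s => ψ s j / ψ s i) 0 t := by
    filter_upwards [hγ.eventually_analyticAt, hγF.eventually_nhds, hγz, hgradQ, hψi]
      with t h1 h2 h3 h4 h5 j
    have hγt := h1.differentiableAt.hasDerivAt
    have h6 : grad F (γ t) ⬝ᵥ deriv γ t = 0 :=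
      ((hasDerivAt_eval (H := F) hγt).congr_of_eventuallyEq
        (h2.mono fun s hs => hs.symm)).unique (hasDerivAt_const t (0 : ℂ))
    obtain ⟨a, b, hab⟩ := exists_eq_smul_add_smul hFd h2.self_of_nhds (h3 ▸ hz) h4 h6
    rw [hab] at hγt
    have h7 := hasDerivAt_evalVec hΨ hγt
    have h8 := hasDerivAt_pi.1 h7
    refine ((h8 j).div (h8 i) h5).congr_deriv ?_
    obtain ⟨c, hc⟩ := exists_smul_eq_of_cross_eq_zero (fun h0 => h5 (congrFun h0 i))
      (h _ h2.self_of_nhds)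
    rw [← hc]
    simp only [Pi.add_apply, Pi.smul_apply, smul_eq_mul]
    rw [div_eq_zero_iff]
    left; ring
  obtain ⟨ε, hε, hball⟩ := Metric.eventually_nhds_iff_ball.1 hderiv
  let Q : Vec := fun j => ψ 0 j / ψ 0 i
  have hconst : ∀ t ∈ Metric.ball (0 : ℂ) ε, ∀ j, ψ t j / ψ t i = Q j := fun t ht j =>
    Metric.isOpen_ball.is_const_of_deriv_eq_zero (convex_ball _ _).isPreconnected
      (fun s hs => (hball s hs j).differentiableAt.differentiableWithinAt)
      (fun s hs => (hball s hs j).deriv) ht (Metric.mem_ball_self hε)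
  refine ⟨Q, fun h0 => ?_, fun v hv => ?_⟩
  · have := congrFun h0 i
    simp [Q, div_self hψi.self_of_nhds] at this
  · have hev : ∀ u j, eval u (((fun l => C (Q l)) ⨯₃ Ψ) j) = (Q ⨯₃ evalVec Ψ u) j := by
      intro u j
      fin_cases j <;> simp [cross_apply, evalVec]
    ext j
    obtain ⟨K, hK⟩ : F ∣ ((fun l => C (Q l)) ⨯₃ Ψ) j := by
      refine dvd_of_eventually_eval_eq_zero (k := e) hF hFd ?_ hγ'
        (smul_ne_zero hb hτ) hz hγF hγz ?_
      · fin_cases j <;> simp only [cross_apply] <;>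
          exact ((hΨ _).C_mul _).sub ((hΨ _).C_mul _)
      · filter_upwards [Metric.ball_mem_nhds (0 : ℂ) hε, hψi] with t ht hti
        have : evalVec Ψ (γ t) = ψ t i • Q := by
          ext l
          rw [Pi.smul_apply, ← hconst t ht l, smul_eq_mul, mul_div_cancel₀ _ hti]
        rw [hev, this, smul_cross_self]
        rfl
    rw [← hev, hK, map_mul, hv, zero_mul]
    rfl

/-! ### The points of contact of the reflected lines -/

lemma evalVec_cross (A B : Fin 3 → Form) (v : Vec) :
    evalVec (A ⨯₃ B) v = evalVec A v ⨯₃ evalVec B v := by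
  ext i
  fin_cases i <;> simp [cross_apply, evalVec]

lemma cross_cross_eq_zero {p q a : Vec} (hp : a ⬝ᵥ p = 0) (hq : a ⬝ᵥ q = 0) :
    p ⨯₃ q ⨯₃ a = 0 := by
  rw [dot_eq_add] at hp hq
  ext i
  fin_cases i <;> simp [cross_apply]
  · linear_combination q 0 * hp - p 0 * hq
  · linear_combination q 1 * hp - p 1 * hq
  · linear_combination q 2 * hp - p 2 * hq

/-- The forms giving the point of contact: the intersection of the reflected line with its
derivative along the curve. -/
noncomputable def contactForms (F : Form) (S : Vec) : Fin 3 → Form :=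
  reflForms F S ⨯₃ tangentDerivVec F (reflForms F S)

lemma isHomogeneous_contactForms {F : Form} {d : ℕ} (hd : 2 ≤ d) (hF : F.IsHomogeneous d) (S : Vec)
    (i : Fin 3) : (contactForms F S i).IsHomogeneous (5 * d - 4) := by
  have h1 := isHomogeneous_reflForms hd hF S
  have h2 : ∀ i, (tangentDerivVec F (reflForms F S) i).IsHomogeneous (3 * d - 3) := fun i => by
    have := isHomogeneous_tangentDeriv hd (by omega) hF (h1 i)
    rwa [show 2 * d - 1 + d - 2 = 3 * d - 3 by omega] at this
  have e : 2 * d - 1 + (3 * d - 3) = 5 * d - 4 := by omega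
  rw [← e]
  fin_cases i <;> exact ((h1 _).mul (h2 _)).sub ((h1 _).mul (h2 _))

/-- The points of contact at `m` are given by the values of `contactForms`: since `∇F(m) ≠ 0`, all
arcs through `m` have the same tangent direction. -/
lemma isCausticPoint_iff {F : Form} {d : ℕ} (hd : 2 ≤ d) (hF : F.IsHomogeneous d) {S m : Vec}
    (hS : S ≠ 0) {P : Plane} : IsCausticPoint F S m P ↔ IsMirrorPoint F S m ∧
      ∃ h : evalVec (contactForms F S) m ≠ 0, P = Projectivization.mk ℂ _ h := by
  have hρ := isHomogeneous_reflForms hd hF S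
  constructor
  · rintro ⟨γ, l, hγ, hl, rfl, hev, hli, hP, hP'⟩
    obtain ⟨hm, hr⟩ := hev.self_of_nhds
    have hρ0 : reflectedVec F S (γ 0) ≠ 0 := (isReflectedLine_reflectedVec hF hS hm).1
    have hγ' := hγ.differentiableAt.hasDerivAt
    have hF0 : grad F (γ 0) ⬝ᵥ deriv γ 0 = 0 :=
      ((hasDerivAt_eval (H := F) hγ').congr_of_eventuallyEq
        (hev.mono fun s hs => hs.1.1.symm)).unique (hasDerivAt_const 0 (0 : ℂ))
    obtain ⟨a, b, hab⟩ := exists_eq_smul_add_smul hF hm.1 hm.2.2.1 hm.2.2.2 hF0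
    rw [hab] at hγ'
    have hcross := (hasDerivAt_cross (hasDerivAt_evalVec hρ hγ')
      hl.differentiableAt.hasDerivAt).congr_of_eventuallyEq (f₁ := fun _ => (0 : Vec))
      (hev.mono fun s hs => by
        simp only [evalVec_reflForms]
        exact (hs.2.cross_eq_zero hF hS hs.1).symm)
    have hzero := hcross.unique (hasDerivAt_const 0 (0 : Vec))
    obtain ⟨κ, hκ⟩ := exists_smul_eq_of_cross_eq_zero hρ0 (hr.cross_eq_zero hF hS hm)
    have hΦ : l 0 ⨯₃ deriv l 0 = (κ ^ 2 * b) • evalVec (contactForms F S) (γ 0) := by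
      rw [contactForms, evalVec_cross]
      rw [← evalVec_reflForms] at hκ
      generalize evalVec (reflForms F S) (γ 0) = r at *
      generalize evalVec (tangentDerivVec F (reflForms F S)) (γ 0) = r' at *
      rw [← hκ] at hzero ⊢
      simp only [map_add, map_smul, LinearMap.add_apply, LinearMap.smul_apply, cross_self,
        smul_zero, zero_add] at hzero ⊢
      rw [← cross_anticomm r r'] at hzero
      have h1 : r ⨯₃ deriv l 0 = (κ * b) • (r ⨯₃ r') := by
        rw [← sub_eq_zero, ← hzero]
        module
      rw [h1]
      module
    have hne := crossProduct_ne_zero_iff_linearIndependent.2 hli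
    rw [hΦ] at hne
    refine ⟨hm, (smul_ne_zero_iff.1 hne).2, ?_⟩
    rw [← P.mk_rep]
    refine (mk_eq_mk_of_cross_eq_zero _ P.rep_nonzero ?_).symm
    have h1 : l 0 ⨯₃ deriv l 0 ⨯₃ P.rep = 0 :=
      cross_cross_eq_zero (by rw [dotProduct_comm, hP]) (by rw [dotProduct_comm, hP'])
    rw [hΦ, map_smul, LinearMap.smul_apply] at h1
    exact (smul_eq_zero.1 h1).resolve_left (smul_ne_zero_iff.1 hne).1
  · rintro ⟨hm, h, rfl⟩
    obtain ⟨γ, hγ, rfl, hγF, hγz, b, hb, hγ'⟩ := exists_analytic_arc hm.1 hm.2.2.2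
    have hmir : ∀ᶠ t in 𝓝 (0 : ℂ), IsMirrorPoint F S (γ t) := by
      have h1 : ∀ᶠ t in 𝓝 (0 : ℂ), γ t ⨯₃ S ≠ 0 := by
        have hc : ContinuousAt (fun t => γ t ⨯₃ S) 0 :=
          (LinearMap.continuous_of_finiteDimensional (crossProduct.flip S)).continuousAt.comp
            hγ.continuousAt
        refine hc.eventually_ne fun h0 => ?_
        have := incident_ne hS hm
        simp [h0] at this
      have h2 : ∀ᶠ t in 𝓝 (0 : ℂ), gradQ F (γ t) ≠ 0 :=
        ((continuous_gradQ F).continuousAt.comp hγ.continuousAt).eventually_ne hm.2.2.2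
      filter_upwards [hγF, hγz, h1, h2] with t h3 h4 h5 h6
      refine ⟨h3, fun c hc => h5 ?_, h4 ▸ hm.2.2.1, h6⟩
      rw [hc, map_smul, LinearMap.smul_apply, cross_self, smul_zero]
    have hl : HasDerivAt (fun t => evalVec (reflForms F S) (γ t))
        (b • evalVec (tangentDerivVec F (reflForms F S)) (γ 0)) 0 := by
      have := hasDerivAt_evalVec hρ (a := 0) (b := b) (by rwa [zero_smul, zero_add])
      rwa [zero_mul, zero_smul, zero_add] at this
    obtain ⟨c, -, hc⟩ := rep_mk_eq_smul h
    refine ⟨γ, fun t => evalVec (reflForms F S) (γ t), hγ, ?_, rfl, ?_, ?_, ?_, ?_⟩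
    · refine AnalyticAt.pi fun i => ?_
      exact (AnalyticOnNhd.eval_mvPolynomial (reflForms F S i) (γ 0) (Set.mem_univ _)).comp hγ
    · filter_upwards [hmir] with t ht
      refine ⟨ht, ?_⟩
      simp only [evalVec_reflForms]
      exact isReflectedLine_reflectedVec hF hS ht
    · rw [hl.deriv, ← crossProduct_ne_zero_iff_linearIndependent, map_smul, ← evalVec_cross]
      exact smul_ne_zero hb h
    · rw [hc, dotProduct_smul, contactForms, evalVec_cross, dot_self_cross, smul_zero]
    · rw [hl.deriv, hc, dotProduct_smul, smul_dotProduct, contactForms, evalVec_cross,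
        dot_cross_self, smul_zero, smul_zero]

/-! ### Nondegeneracy -/

lemma not_dvd_of_isHomogeneous_of_lt {F H : Form} {d k : ℕ} (hF : F.IsHomogeneous d)
    (hH : H.IsHomogeneous k) (h : k < d) (h0 : H ≠ 0) : ¬ F ∣ H := by
  rintro ⟨K, rfl⟩
  have := hH.totalDegree h0
  rw [totalDegree_mul_of_isDomain (left_ne_zero_of_mul h0) (right_ne_zero_of_mul h0),
    hF.totalDegree (left_ne_zero_of_mul h0)] at this
  omega

/-- The linear form with coefficients `a`. -/
noncomputable def linForm (a : Vec) : Form := ∑ i, C (a i) * X i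

lemma isHomogeneous_linForm (a : Vec) : (linForm a).IsHomogeneous 1 :=
  IsHomogeneous.sum _ _ _ fun i _ => (isHomogeneous_X ℂ i).C_mul _

lemma eval_linForm (a v : Vec) : eval v (linForm a) = a ⬝ᵥ v := by
  simp [linForm, dotProduct]

lemma linForm_ne_zero {a : Vec} (ha : a ≠ 0) : linForm a ≠ 0 := by
  obtain ⟨i, hi⟩ := Function.ne_iff.1 ha
  intro h
  have := eval_linForm a (Pi.single i 1)
  rw [h, map_zero, dotProduct_single_one] at this
  exact hi this.symm

lemma not_dvd_linForm {F : Form} {d : ℕ} (hd : 2 ≤ d) (hF : F.IsHomogeneous d) {a : Vec}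
    (ha : a ≠ 0) : ¬ F ∣ linForm a :=
  not_dvd_of_isHomogeneous_of_lt hF (isHomogeneous_linForm a) (by omega) (linForm_ne_zero ha)

lemma not_dvd_X {F : Form} {d : ℕ} (hd : 2 ≤ d) (hF : F.IsHomogeneous d) (i : Fin 3) : ¬ F ∣ X i :=
  not_dvd_of_isHomogeneous_of_lt hF (isHomogeneous_X ℂ i) (by omega) (X_ne_zero i)

/-- The gradient is not isotropic along the whole curve: otherwise `F` would be invariant under
translations in an isotropic direction, and the curve would contain a line. -/
lemma not_dvd_gradQ {F : Form} {d : ℕ} (hd : 2 ≤ d) (hF : Irreducible F) (hFd : F.IsHomogeneous d) :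
    ¬ F ∣ pderiv 0 F ^ 2 + pderiv 1 F ^ 2 := by
  have key : ∀ ε : ℂ, ¬ F ∣ pderiv 0 F + C ε * pderiv 1 F := by
    intro ε hdvd
    have hzero : pderiv 0 F + C ε * pderiv 1 F = 0 := by
      by_contra h0
      exact not_dvd_of_isHomogeneous_of_lt hFd (hFd.pderiv.add (hFd.pderiv.C_mul _)) (by omega) h0
        hdvd
    obtain ⟨p, hp, hp2⟩ := exists_eval_ne_zero hF (not_dvd_X hd hFd 2)
    rw [eval_X] at hp2
    let u : Vec := ![1, ε, 0]
    have hγ : ∀ t : ℂ, HasDerivAt (fun t : ℂ => p + t • u) u t := fun t => by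
      refine (((hasDerivAt_id t).smul_const u).const_add p).congr_deriv ?_
      rw [one_smul]
    have hconst : ∀ t : ℂ, eval (p + t • u) F = 0 := by
      intro t
      have hd : ∀ t : ℂ, HasDerivAt (fun t : ℂ => eval (p + t • u) F) 0 t := fun t => by
        refine (hasDerivAt_eval (hγ t)).congr_deriv ?_
        have := congrArg (eval (p + t • u)) hzero
        rw [map_add, map_mul, eval_C, map_zero] at this
        rw [dot_eq_add]
        simp only [u, grad, Matrix.cons_val]
        linear_combination this
      rw [is_const_of_deriv_eq_zero (fun t => (hd t).differentiableAt) (fun t => (hd t).deriv) t 0,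
        zero_smul, add_zero, hp]
    have hu : u ≠ 0 := fun h => by simpa [u] using congrFun h 0
    have hpu : p ⨯₃ u ≠ 0 := fun h => hp2 (by simpa [u, cross_apply] using congrFun h 1)
    refine not_dvd_linForm hd hFd hpu (dvd_of_eventually_eval_eq_zero hF hFd
      (isHomogeneous_linForm _) (hγ 0) hu hp2 (.of_forall hconst)
      (.of_forall fun t => by simp [u]) (.of_forall fun t => ?_))
    rw [eval_linForm, dotProduct_add, dotProduct_smul, dotProduct_comm, dot_self_cross,
      dotProduct_comm, dot_cross_self, smul_zero, add_zero]
  intro h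
  have : pderiv 0 F ^ 2 + pderiv 1 F ^ 2 =
      (pderiv 0 F + C Complex.I * pderiv 1 F) * (pderiv 0 F + C (-Complex.I) * pderiv 1 F) := by
    have hI : (C Complex.I : Form) * C Complex.I = -1 := by
      rw [← C_mul, Complex.I_mul_I, C_neg, C_1]
    rw [C_neg]
    linear_combination pderiv 1 F ^ 2 * hI
  rw [this] at h
  exact (hF.prime.dvd_or_dvd h).elim (key _) (key _)

/-- The points of the curve that are not mirror points lie on an auxiliary curve. -/
lemma exists_form_isMirrorPoint {F : Form} {d : ℕ} (hd : 2 ≤ d) (hF : Irreducible F)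
    (hFd : F.IsHomogeneous d) (S : Vec) : ∃ (M : Form) (k : ℕ), M.IsHomogeneous k ∧
      ¬ F ∣ M ∧ ∀ m, eval m F = 0 → eval m M ≠ 0 → IsMirrorPoint F S m := by
  obtain ⟨a, ha0, haS⟩ : ∃ a : Vec, a ≠ 0 ∧ a ⬝ᵥ S = 0 := by
    by_cases h : S 0 = 0
    · exact ⟨![1, 0, 0], fun h => by simpa using congrFun h 0, by rw [dot_eq_add]; simp [h]⟩
    · exact ⟨![S 1, -S 0, 0], fun h' => h (by simpa using congrFun h' 1),
        by rw [dot_eq_add]; simp; ring⟩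
  refine ⟨linForm a * X 2 * (pderiv 0 F ^ 2 + pderiv 1 F ^ 2), _,
    ((isHomogeneous_linForm a).mul (isHomogeneous_X ℂ 2)).mul
      ((hFd.pderiv.pow 2).add (hFd.pderiv.pow 2)), fun h => ?_, fun m hm h => ?_⟩
  · rcases hF.prime.dvd_or_dvd h with h | h
    · rcases hF.prime.dvd_or_dvd h with h | h
      · exact not_dvd_linForm hd hFd ha0 h
      · exact not_dvd_X hd hFd 2 h
    · exact not_dvd_gradQ hd hF hFd h
  · rw [map_mul, map_mul, eval_linForm, eval_X, map_add, map_pow, map_pow] at h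
    refine ⟨hm, ?_, right_ne_zero_of_mul (left_ne_zero_of_mul h), right_ne_zero_of_mul h⟩
    rintro c rfl
    rw [dotProduct_smul, haS] at h
    simp at h

/-- The reflected lines do not all coincide: the curve would be contained in a line. -/
lemma not_constant_reflForms {F : Form} {d : ℕ} (hd : 2 ≤ d) (hF : Irreducible F)
    (hFd : F.IsHomogeneous d) {S : Vec} (hS : S ≠ 0) :
    ¬ ∃ Q : Vec, Q ≠ 0 ∧ ∀ v, eval v F = 0 → Q ⨯₃ evalVec (reflForms F S) v = 0 := by
  rintro ⟨Q, hQ, h⟩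
  obtain ⟨M, -, -, hM, hmir⟩ := exists_form_isMirrorPoint hd hF hFd S
  have hdvd : F ∣ M * linForm Q := by
    refine dvd_of_eval_eq_zero hF fun v hv => ?_
    rw [map_mul, eval_linForm, mul_eq_zero, or_iff_not_imp_left]
    intro hMv
    have hline := isReflectedLine_reflectedVec hFd hS (hmir v hv hMv)
    obtain ⟨c, hc⟩ := exists_smul_eq_of_cross_eq_zero hQ (h v hv)
    rw [evalVec_reflForms] at hc
    have h1 := hline.2.1
    have h2 := hline.1
    rw [← hc] at h1 h2
    rw [smul_dotProduct] at h1
    exact (smul_eq_zero.1 h1).resolve_left (smul_ne_zero_iff.1 h2).1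
  exact (hF.prime.dvd_or_dvd hdvd).elim hM (not_dvd_linForm hd hFd hQ)

lemma exists_not_dvd_reflForms {F : Form} {d : ℕ} (hd : 2 ≤ d) (hF : Irreducible F)
    (hFd : F.IsHomogeneous d) {S : Vec} (hS : S ≠ 0) : ∃ i, ¬ F ∣ reflForms F S i := by
  by_contra! h
  refine not_constant_reflForms hd hF hFd hS ⟨![1, 0, 0], fun h => by simpa using congrFun h 0,
    fun v hv => ?_⟩
  have : evalVec (reflForms F S) v = 0 := by
    ext i
    obtain ⟨K, hK⟩ := h i
    simp [evalVec, hK, hv]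
  rw [this, map_zero]

/-- If `Ψ` is not constant on the curve, then it is immersive at the generic point. -/
lemma exists_not_dvd_cross_tangentDeriv {F : Form} {d e : ℕ} (hd : 2 ≤ d) (hF : Irreducible F)
    (hFd : F.IsHomogeneous d) {Ψ : Fin 3 → Form} (hΨ : ∀ i, (Ψ i).IsHomogeneous e)
    (hΨ0 : ∃ i, ¬ F ∣ Ψ i)
    (hconst : ¬ ∃ Q : Vec, Q ≠ 0 ∧ ∀ v, eval v F = 0 → Q ⨯₃ evalVec Ψ v = 0) :
    ∃ i, ¬ F ∣ (Ψ ⨯₃ tangentDerivVec F Ψ) i := by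
  by_contra! h
  obtain ⟨i, hi⟩ := hΨ0
  obtain ⟨m, hm, hne⟩ := exists_eval_ne_zero hF
    (B := X 2 * (pderiv 0 F ^ 2 + pderiv 1 F ^ 2) * Ψ i) fun hdvd => by
      rcases hF.prime.dvd_or_dvd hdvd with hdvd | hdvd
      · exact (hF.prime.dvd_or_dvd hdvd).elim (not_dvd_X hd hFd 2) (not_dvd_gradQ hd hF hFd)
      · exact hi hdvd
  rw [map_mul, map_mul, eval_X, map_add, map_pow, map_pow] at hne
  refine hconst (constant_of_cross_tangentDeriv_eq_zero hF hFd hΨ (fun v hv => ?_) hm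
    (left_ne_zero_of_mul (left_ne_zero_of_mul hne)) (right_ne_zero_of_mul (left_ne_zero_of_mul hne))
    fun h0 => right_ne_zero_of_mul hne (congrFun h0 i))
  rw [← evalVec_cross]
  ext j
  obtain ⟨K, hK⟩ := h j
  simp [evalVec, hK, hv]

/-! ### The caustic, its tangent lines and its dual curve -/

lemma subset_zariskiClosure (A : Set Plane) : A ⊆ zariskiClosure A :=
  fun _ hP _ _ _ hA => hA hP

lemma zariskiClosure_congr {A B : Set Plane}
    (h : ∀ (H : Form) (k : ℕ), H.IsHomogeneous k → (A ⊆ zeroLocus H ↔ B ⊆ zeroLocus H)) :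
    zariskiClosure A = zariskiClosure B := by
  ext P
  exact ⟨fun hP H k hk hB => hP H k hk ((h H k hk).2 hB),
    fun hP H k hk hA => hP H k hk ((h H k hk).1 hA)⟩

/-- `A` is the image of the curve `V(F)` under the rational map `Ψ`, except that it may miss values
at points of an auxiliary curve `V(M)` not containing `V(F)`. -/
def IsGenericImage (F : Form) (Ψ : Fin 3 → Form) (A : Set Plane) : Prop :=
  (∀ P ∈ A, ∃ v, eval v F = 0 ∧ ∃ h : evalVec Ψ v ≠ 0, P = Projectivization.mk ℂ _ h) ∧
    ∃ M : Form, ¬ F ∣ M ∧ ∀ v, eval v F = 0 → eval v M ≠ 0 →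
      ∀ h : evalVec Ψ v ≠ 0, Projectivization.mk ℂ _ h ∈ A

lemma IsGenericImage.subset_zeroLocus_iff {F : Form} {Ψ : Fin 3 → Form} {A : Set Plane}
    (hA : IsGenericImage F Ψ A) (hF : Irreducible F) (hΨ0 : ∃ i, ¬ F ∣ Ψ i) {H : Form} {k : ℕ}
    (hH : H.IsHomogeneous k) : A ⊆ zeroLocus H ↔ F ∣ bind₁ Ψ H := by
  obtain ⟨h1, M, hM, h2⟩ := hA
  constructor
  · intro h
    obtain ⟨i, hi⟩ := hΨ0
    have hdvd : F ∣ M * Ψ i * bind₁ Ψ H := by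
      refine dvd_of_eval_eq_zero hF fun v hv => ?_
      rw [map_mul, map_mul, eval_bind₁, mul_eq_zero, or_iff_not_imp_left]
      intro hne
      have hΨv : evalVec Ψ v ≠ 0 := fun h0 => right_ne_zero_of_mul hne (congrFun h0 i)
      exact (mk_mem_zeroLocus hH hΨv).1 (h (h2 v hv (left_ne_zero_of_mul hne) hΨv))
    exact (hF.prime.dvd_or_dvd hdvd).resolve_left fun h =>
      (hF.prime.dvd_or_dvd h).elim hM hi
  · rintro ⟨K, hK⟩ P hP
    obtain ⟨v, hv, hΨv, rfl⟩ := h1 P hP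
    rw [mk_mem_zeroLocus hH]
    have := congrArg (eval v) hK
    rwa [eval_bind₁, map_mul, hv, zero_mul] at this

lemma IsGenericImage.zariskiClosure_eq {F G : Form} {n : ℕ} {Ψ : Fin 3 → Form} {A : Set Plane}
    (hA : IsGenericImage F Ψ A) (hF : Irreducible F) (hΨ0 : ∃ i, ¬ F ∣ Ψ i)
    (hG : G.IsHomogeneous n) (hFG : F ∣ bind₁ Ψ G)
    (hmin : ∀ (H : Form) (k : ℕ), H.IsHomogeneous k → F ∣ bind₁ Ψ H → G ∣ H) :
    zariskiClosure A = zeroLocus G := by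
  ext P
  constructor
  · exact fun hP => hP G n hG ((hA.subset_zeroLocus_iff hF hΨ0 hG).2 hFG)
  · intro hP H k hH hAH
    obtain ⟨K, rfl⟩ := hmin H k hH ((hA.subset_zeroLocus_iff hF hΨ0 hH).1 hAH)
    have hP' : eval P.rep G = 0 := hP
    show eval P.rep (G * K) = 0
    rw [map_mul, hP', zero_mul]

lemma IsGenericImage.zariskiClosure_eq_singleton {F : Form} {Ψ : Fin 3 → Form} {A : Set Plane}
    (hA : IsGenericImage F Ψ A) (hF : Irreducible F) (hΨ0 : ∃ i, ¬ F ∣ Ψ i) {Q : Vec} (hQ : Q ≠ 0)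
    (h : ∀ v, eval v F = 0 → Q ⨯₃ evalVec Ψ v = 0) :
    zariskiClosure A = {Projectivization.mk ℂ Q hQ} := by
  obtain ⟨h1, M, hM, h2⟩ := hA
  have hA' : ∀ P ∈ A, P = Projectivization.mk ℂ Q hQ := by
    intro P hP
    obtain ⟨v, hv, hΨv, rfl⟩ := h1 P hP
    exact (mk_eq_mk_of_cross_eq_zero hQ hΨv (h v hv)).symm
  refine Set.Subset.antisymm (fun P hP => ?_) (Set.singleton_subset_iff.2 ?_)
  · have hj : ∀ a : Vec, a ⬝ᵥ Q = 0 → a ⬝ᵥ P.rep = 0 := by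
      intro a ha
      have : P ∈ zeroLocus (linForm a) := hP _ 1 (isHomogeneous_linForm a) fun R hR => by
        rw [hA' R hR, mk_mem_zeroLocus (isHomogeneous_linForm a), eval_linForm, ha]
      rw [← eval_linForm]
      exact this
    rw [Set.mem_singleton_iff, ← P.mk_rep]
    refine (mk_eq_mk_of_cross_eq_zero hQ P.rep_nonzero ?_).symm
    -- The coordinates of `Q ⨯₃ P` are linear forms in `P` vanishing at `Q`.
    have e0 := hj ![0, -Q 2, Q 1] (by rw [dot_eq_add]; simp; ring)
    have e1 := hj ![Q 2, 0, -Q 0] (by rw [dot_eq_add]; simp; ring)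
    have e2 := hj ![-Q 1, Q 0, 0] (by rw [dot_eq_add]; simp; ring)
    rw [dot_eq_add] at e0 e1 e2
    simp only [Matrix.cons_val] at e0 e1 e2
    ext i
    fin_cases i <;> simp [cross_apply]
    · linear_combination e0
    · linear_combination e1
    · linear_combination e2
  · obtain ⟨i, hi⟩ := hΨ0
    obtain ⟨v, hv, hne⟩ := exists_eval_ne_zero hF (B := M * Ψ i) fun hdvd =>
      (hF.prime.dvd_or_dvd hdvd).elim hM hi
    rw [map_mul] at hne
    have hΨv : evalVec Ψ v ≠ 0 := fun h0 => right_ne_zero_of_mul hne (congrFun h0 i)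
    have hmem := h2 v hv (left_ne_zero_of_mul hne) hΨv
    rw [← hA' _ hmem]
    exact subset_zariskiClosure A hmem

lemma isGenericImage_caustic {F : Form} {d : ℕ} (hd : 2 ≤ d) (hF : Irreducible F)
    (hFd : F.IsHomogeneous d) {S : Vec} (hS : S ≠ 0) :
    IsGenericImage F (contactForms F S) {P | ∃ m, IsCausticPoint F S m P} := by
  obtain ⟨M, -, -, hM, hmir⟩ := exists_form_isMirrorPoint hd hF hFd S
  refine ⟨?_, M, hM, fun v hv hMv h =>
    ⟨v, (isCausticPoint_iff hd hFd hS).2 ⟨hmir v hv hMv, h, rfl⟩⟩⟩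
  rintro P ⟨m, hm⟩
  obtain ⟨hmir, h⟩ := (isCausticPoint_iff hd hFd hS).1 hm
  exact ⟨m, hmir.1, h⟩

lemma evalVec_smul {Ψ : Fin 3 → Form} {e : ℕ} (hΨ : ∀ i, (Ψ i).IsHomogeneous e) (c : ℂ) (v : Vec) :
    evalVec Ψ (c • v) = c ^ e • evalVec Ψ v :=
  funext fun i => eval_smul_of_isHomogeneous (hΨ i) c v

lemma isGenericImage_reflectedImage {F : Form} {d : ℕ} (hd : 2 ≤ d) (hF : Irreducible F)
    (hFd : F.IsHomogeneous d) (S : Vec) :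
    IsGenericImage F (reflForms F S) (reflectedImage F S) := by
  have hρ := isHomogeneous_reflForms hd hFd S
  refine ⟨?_, 1, hF.not_dvd_one, fun v hv _ h => ?_⟩
  · rintro L ⟨m, hm, h, rfl⟩
    refine ⟨m.rep, hm, by rwa [evalVec_reflForms], ?_⟩
    simp only [evalVec_reflForms]
  · have hv0 : v ≠ 0 := by
      rintro rfl
      have := evalVec_smul hρ 0 0
      rw [zero_smul, zero_pow (by omega), zero_smul] at this
      exact h this
    obtain ⟨c, hc, hrep⟩ := rep_mk_eq_smul hv0
    have hr : reflectedVec F S (Projectivization.mk ℂ v hv0).rep =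
        c ^ (2 * d - 1) • evalVec (reflForms F S) v := by
      rw [← evalVec_reflForms, hrep, evalVec_smul hρ]
    have hne : reflectedVec F S (Projectivization.mk ℂ v hv0).rep ≠ 0 := by
      rw [hr]; exact smul_ne_zero (pow_ne_zero _ hc) h
    refine ⟨Projectivization.mk ℂ v hv0, (mk_mem_zeroLocus hFd hv0).2 hv, hne, ?_⟩
    refine mk_eq_mk_of_cross_eq_zero h hne ?_
    rw [hr, smul_cross_self]

/-- The chain rule for `tangentDeriv`. -/
lemma eval_tangentDeriv_bind₁ (F : Form) (Ψ : Fin 3 → Form) (G : Form) (v : Vec) :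
    eval v (tangentDeriv F (bind₁ Ψ G)) =
      grad G (evalVec Ψ v) ⬝ᵥ evalVec (tangentDerivVec F Ψ) v := by
  rw [dot_eq_add]
  induction G using MvPolynomial.induction_on with
  | C c => simp [grad, algebraMap_eq]
  | add p q hp hq =>
    simp only [map_add, hp, hq, grad]
    ring
  | mul_X p i hp =>
    have he : eval v (bind₁ Ψ p) = eval (evalVec Ψ v) p := eval_bind₁ Ψ p v
    rw [map_mul, bind₁_X_right, Derivation.leibniz, map_add, smul_eq_mul, smul_eq_mul, map_mul,
      map_mul, hp, he]
    fin_cases i <;> simp [grad, evalVec, tangentDerivVec, pderiv_X] <;> ring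

/-- The derivative along the curve of the point of contact lies on the reflected line. -/
lemma dot_tangentDerivVec_contactForms (F : Form) (S v : Vec) :
    evalVec (reflForms F S) v ⬝ᵥ evalVec (tangentDerivVec F (contactForms F S)) v = 0 := by
  rw [dot_eq_add]
  simp only [evalVec, tangentDerivVec, contactForms, cross_apply, Matrix.cons_val, map_sub,
    Derivation.leibniz, smul_eq_mul, map_add, map_mul]
  ring

/-- Where the caustic map is immersive, the reflected line is proportional to the gradient, at the
point of contact, of any equation of the caustic: both are orthogonal to the point of contact and to
its derivative. -/
lemma reflForms_cross_grad {F G : Form} {n : ℕ} (S : Vec) (hG : G.IsHomogeneous n)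
    (hFG : F ∣ bind₁ (contactForms F S) G) {v : Vec} (hv : eval v F = 0)
    (himm : evalVec (contactForms F S ⨯₃ tangentDerivVec F (contactForms F S)) v ≠ 0) :
    evalVec (reflForms F S) v ⨯₃ grad G (evalVec (contactForms F S) v) = 0 := by
  have heval : ∀ K : Form, F ∣ K → eval v K = 0 := by
    rintro _ ⟨K, rfl⟩; rw [map_mul, hv, zero_mul]
  have h1 : grad G (evalVec (contactForms F S) v) ⬝ᵥ evalVec (contactForms F S) v = 0 := by
    have := heval _ hFG
    rw [eval_bind₁] at this
    rw [dot_grad_self hG]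
    exact mul_eq_zero_of_right _ this
  have h2 := heval _ (dvd_tangentDeriv hFG)
  rw [eval_tangentDeriv_bind₁] at h2
  have h3 : evalVec (reflForms F S) v ⬝ᵥ evalVec (contactForms F S) v = 0 := by
    rw [contactForms, evalVec_cross, dot_self_cross]
  rw [evalVec_cross] at himm
  obtain ⟨a, ha⟩ := exists_smul_eq_of_cross_eq_zero himm (cross_cross_eq_zero h1 h2)
  obtain ⟨b, hb⟩ := exists_smul_eq_of_cross_eq_zero himm
    (cross_cross_eq_zero h3 (dot_tangentDerivVec_contactForms F S v))
  rw [← ha, ← hb, map_smul, map_smul, LinearMap.smul_apply, cross_self, smul_zero, smul_zero]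

/-- An irreducible form does not divide all its partial derivatives. -/
lemma exists_not_dvd_pderiv {G : Form} {n : ℕ} (hG : Irreducible G) (hGn : G.IsHomogeneous n) :
    ∃ i, ¬ G ∣ pderiv i G := by
  by_contra! h
  have hn : n ≠ 0 := by
    rintro rfl
    rw [← totalDegree_zero_iff_isHomogeneous, totalDegree_eq_zero_iff_eq_C] at hGn
    have hc : coeff 0 G ≠ 0 := fun h0 => hG.ne_zero (by rw [hGn, h0, C_0])
    exact hG.not_isUnit (hGn ▸ (isUnit_iff_ne_zero.2 hc).map C)
  have hzero : ∀ i, pderiv i G = 0 := fun i => by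
    by_contra h0
    exact not_dvd_of_isHomogeneous_of_lt hGn hGn.pderiv (by omega) h0 (h i)
  have := hGn.sum_X_mul_pderiv
  simp only [hzero, mul_zero, Finset.sum_const_zero] at this
  exact (smul_ne_zero hn hG.ne_zero) this.symm

/-- An equation of `V(G)`, with `G` irreducible, is a multiple of `G`. -/
lemma dvd_of_zeroLocus_eq {G G' : Form} {n n' : ℕ} (hG : Irreducible G) (hGn : G.IsHomogeneous n)
    (hG' : G'.IsHomogeneous n') (h : zeroLocus G = zeroLocus G') {P : Plane}
    (hP : P ∈ zeroLocus G') : G ∣ G' := by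
  refine dvd_of_eval_eq_zero hG fun v hv => ?_
  by_cases hv0 : v = 0
  · have hP' : eval P.rep G' = 0 := hP
    rw [hv0, ← zero_smul ℂ P.rep, eval_smul_of_isHomogeneous hG', hP', mul_zero]
  · rw [← mk_mem_zeroLocus hG' hv0, ← h, mk_mem_zeroLocus hGn hv0]
    exact hv

/-- The Gauss map of `V(G)`, with `G` irreducible, is given by `∇G`, whichever reduced equation is
used to define it. -/
lemma IsTangentLine.exists_smul_grad {G : Form} {n : ℕ} (hG : Irreducible G)
    (hGn : G.IsHomogeneous n) {P L : Plane} (h : IsTangentLine (zeroLocus G) P L) :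
    ∃ c : ℂ, L.rep = c • grad G P.rep := by
  obtain ⟨hP, G', n', ⟨hG', -, hZ⟩, hne, rfl⟩ := h
  obtain ⟨K, rfl⟩ := dvd_of_zeroLocus_eq hG hGn hG' hZ (hZ ▸ hP)
  obtain ⟨c, -, hc⟩ := rep_mk_eq_smul hne
  have hP' : eval P.rep G = 0 := hP
  refine ⟨c * eval P.rep K, ?_⟩
  rw [hc]
  ext i
  simp [grad, hP']
  ring

lemma isTangentLine_mk {G : Form} {n : ℕ} (hG : Irreducible G) (hGn : G.IsHomogeneous n) {p l : Vec}
    (hp : p ≠ 0) (hl : l ≠ 0) (hG0 : eval p G = 0) (hgrad : grad G p ≠ 0)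
    (hcross : l ⨯₃ grad G p = 0) :
    IsTangentLine (zeroLocus G) (Projectivization.mk ℂ p hp) (Projectivization.mk ℂ l hl) := by
  obtain ⟨a, ha, hrep⟩ := rep_mk_eq_smul hp
  have hgr : grad G (Projectivization.mk ℂ p hp).rep = a ^ (n - 1) • grad G p := by
    rw [hrep]
    ext i
    exact eval_smul_of_isHomogeneous (hGn.pderiv (i := i)) a p
  have hne : grad G (Projectivization.mk ℂ p hp).rep ≠ 0 := by
    rw [hgr]; exact smul_ne_zero (pow_ne_zero _ ha) hgrad
  refine ⟨(mk_mem_zeroLocus hGn hp).2 hG0, G, n, ⟨hGn, hG.squarefree, rfl⟩, hne,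
    mk_eq_mk_of_cross_eq_zero hl hne ?_⟩
  rw [hgr, map_smul, hcross, smul_zero]

/-- At a mirror point where the caustic map is immersive and its image is nonsingular, the reflected
line is the tangent line to the caustic at the point of contact. -/
lemma isTangentLine_contact {F G : Form} {d n : ℕ} (hF : F.IsHomogeneous d) {S : Vec} (hS : S ≠ 0)
    (hG : Irreducible G) (hGn : G.IsHomogeneous n) (hFG : F ∣ bind₁ (contactForms F S) G) {v : Vec}
    (hm : IsMirrorPoint F S v)
    (himm : evalVec (contactForms F S ⨯₃ tangentDerivVec F (contactForms F S)) v ≠ 0)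
    (hgrad : grad G (evalVec (contactForms F S) v) ≠ 0) :
    ∃ (h₁ : evalVec (contactForms F S) v ≠ 0) (h₂ : evalVec (reflForms F S) v ≠ 0),
      IsTangentLine (zeroLocus G) (Projectivization.mk ℂ _ h₁) (Projectivization.mk ℂ _ h₂) := by
  have h1 : evalVec (contactForms F S) v ≠ 0 := fun h => himm (by
    rw [evalVec_cross, h, map_zero, LinearMap.zero_apply])
  have h2 : evalVec (reflForms F S) v ≠ 0 := by
    rw [evalVec_reflForms]; exact (isReflectedLine_reflectedVec hF hS hm).1
  have hcross := reflForms_cross_grad S hGn hFG hm.1 himm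
  have hG0 : eval (evalVec (contactForms F S) v) G = 0 := by
    obtain ⟨K, hK⟩ := hFG
    have := congrArg (eval v) hK
    rwa [eval_bind₁, map_mul, hm.1, zero_mul] at this
  exact ⟨h1, h2, isTangentLine_mk hG hGn h1 h2 hG0 hgrad hcross⟩

/-- The points of the curve where the hypotheses of `isTangentLine_contact` fail lie on an auxiliary
curve. -/
lemma exists_form_generic {F G : Form} {d n : ℕ} (hd : 2 ≤ d) (hF : Irreducible F)
    (hFd : F.IsHomogeneous d) {S : Vec} (hΦ0 : ∃ i, ¬ F ∣ contactForms F S i)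
    (hΦc : ¬ ∃ Q : Vec, Q ≠ 0 ∧ ∀ v, eval v F = 0 → Q ⨯₃ evalVec (contactForms F S) v = 0)
    (hG : Irreducible G) (hGn : G.IsHomogeneous n)
    (hmin : ∀ (H : Form) (k : ℕ), H.IsHomogeneous k → F ∣ bind₁ (contactForms F S) H → G ∣ H) :
    ∃ (B : Form) (b : ℕ), B.IsHomogeneous b ∧ ¬ F ∣ B ∧
      ∀ v, eval v F = 0 → eval v B ≠ 0 → IsMirrorPoint F S v ∧
        evalVec (contactForms F S ⨯₃ tangentDerivVec F (contactForms F S)) v ≠ 0 ∧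
        grad G (evalVec (contactForms F S) v) ≠ 0 := by
  have hΦ := isHomogeneous_contactForms hd hFd S
  obtain ⟨M, k, hM, hFM, hmir⟩ := exists_form_isMirrorPoint hd hF hFd S
  obtain ⟨i, hi⟩ := exists_not_dvd_cross_tangentDeriv hd hF hFd hΦ hΦ0 hΦc
  obtain ⟨j, hj⟩ := exists_not_dvd_pderiv hG hGn
  have hΦ' : ∀ i, (tangentDerivVec F (contactForms F S) i).IsHomogeneous (5 * d - 4 + d - 2) :=
    fun i => isHomogeneous_tangentDeriv hd (by omega) hFd (hΦ i)
  have hW : ((contactForms F S ⨯₃ tangentDerivVec F (contactForms F S)) i).IsHomogeneous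
      (5 * d - 4 + (5 * d - 4 + d - 2)) := by
    fin_cases i <;> exact ((hΦ _).mul (hΦ' _)).sub ((hΦ _).mul (hΦ' _))
  refine ⟨_, _, (hM.mul hW).mul (isHomogeneous_bind₁ (hGn.pderiv (i := j)) hΦ), fun h => ?_,
    fun v hv hne => ?_⟩
  · rcases hF.prime.dvd_or_dvd h with h | h
    · exact (hF.prime.dvd_or_dvd h).elim hFM hi
    · exact hj (hmin _ _ hGn.pderiv h)
  · rw [map_mul, map_mul, eval_bind₁] at hne
    exact ⟨hmir v hv (left_ne_zero_of_mul (left_ne_zero_of_mul hne)),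
      fun h => right_ne_zero_of_mul (left_ne_zero_of_mul hne) (congrFun h i),
      fun h => right_ne_zero_of_mul hne (congrFun h j)⟩

/-- The forms vanishing on the tangent lines of the caustic are those vanishing on the reflected
lines. -/
lemma tangentLines_subset_iff {F G B : Form} {d n : ℕ} (hF : Irreducible F)
    (hFd : F.IsHomogeneous d) {S : Vec} (hS : S ≠ 0) (hG : Irreducible G) (hGn : G.IsHomogeneous n)
    (hFG : F ∣ bind₁ (contactForms F S) G)
    (hmin : ∀ (H : Form) (k : ℕ), H.IsHomogeneous k → F ∣ bind₁ (contactForms F S) H → G ∣ H)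
    (hFB : ¬ F ∣ B) (hB : ∀ v, eval v F = 0 → eval v B ≠ 0 → IsMirrorPoint F S v ∧
      evalVec (contactForms F S ⨯₃ tangentDerivVec F (contactForms F S)) v ≠ 0 ∧
      grad G (evalVec (contactForms F S) v) ≠ 0) {H : Form} {k : ℕ} (hH : H.IsHomogeneous k) :
    {L | ∃ P, IsTangentLine (zeroLocus G) P L} ⊆ zeroLocus H ↔ F ∣ bind₁ (reflForms F S) H := by
  constructor
  · intro h
    have hdvd : F ∣ B * bind₁ (reflForms F S) H := by
      refine dvd_of_eval_eq_zero hF fun v hv => ?_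
      rw [map_mul, eval_bind₁, mul_eq_zero, or_iff_not_imp_left]
      intro hBv
      obtain ⟨hm, himm, hgrad⟩ := hB v hv hBv
      obtain ⟨h1, h2, htan⟩ := isTangentLine_contact hFd hS hG hGn hFG hm himm hgrad
      exact (mk_mem_zeroLocus hH h2).1 (h ⟨_, htan⟩)
    exact (hF.prime.dvd_or_dvd hdvd).resolve_left hFB
  · rintro ⟨K, hK⟩ L ⟨P, htan⟩
    -- `H ∘ ∇G` vanishes at the generic point of the caustic, hence on the caustic.
    have hdvd : F ∣ B * bind₁ (contactForms F S) (bind₁ (fun i => pderiv i G) H) := by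
      refine dvd_of_eval_eq_zero hF fun v hv => ?_
      rw [map_mul, eval_bind₁, eval_bind₁, mul_eq_zero, or_iff_not_imp_left]
      intro hBv
      obtain ⟨hm, himm, -⟩ := hB v hv hBv
      have h2 : evalVec (reflForms F S) v ≠ 0 := by
        rw [evalVec_reflForms]; exact (isReflectedLine_reflectedVec hFd hS hm).1
      obtain ⟨c, hc⟩ := exists_smul_eq_of_cross_eq_zero h2 (reflForms_cross_grad S hGn hFG hv himm)
      have h0 := congrArg (eval v) hK
      rw [eval_bind₁, map_mul, hv, zero_mul] at h0
      change eval (grad G (evalVec (contactForms F S) v)) H = 0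
      rw [← hc, eval_smul_of_isHomogeneous hH]
      exact mul_eq_zero_of_right _ h0
    obtain ⟨N, hN⟩ := hmin _ _ (isHomogeneous_bind₁ hH fun i => hGn.pderiv)
      ((hF.prime.dvd_or_dvd hdvd).resolve_left hFB)
    have hP : eval P.rep G = 0 := htan.1
    have h0 := congrArg (eval P.rep) hN
    rw [eval_bind₁, map_mul, hP, zero_mul] at h0
    obtain ⟨c, hc⟩ := htan.exists_smul_grad hG hGn
    change eval L.rep H = 0
    rw [hc, eval_smul_of_isHomogeneous hH]
    exact mul_eq_zero_of_right _ h0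

end Caustic

open Caustic MvPolynomial in
theorem mainTheorem4 (F : Caustic.Form) (d : ℕ) (hd : 2 ≤ d) (hF : F.IsHomogeneous d)
    (hirr : Irreducible F) (S : Caustic.Vec) (hS : S ≠ 0)
    (hpoint : ¬ ∃ P : Caustic.Plane, Caustic.caustic F S = {P}) :
    Caustic.IsIrreducibleCurve (Caustic.caustic F S) ∧
    Caustic.IsIrreducibleCurve (Caustic.zariskiClosure (Caustic.reflectedImage F S)) ∧
    {m ∈ Caustic.zeroLocus F |
      ¬ ∃ P L : Caustic.Plane, (∀ P', Caustic.IsCausticPoint F S m.rep P' ↔ P' = P) ∧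
        Caustic.IsReflectedImage F S m L ∧
        Caustic.IsTangentLine (Caustic.caustic F S) P L}.Finite ∧
    Caustic.curveClass (Caustic.caustic F S) =
      Caustic.curveDegree (Caustic.zariskiClosure (Caustic.reflectedImage F S)) := by
  have hρ := isHomogeneous_reflForms hd hF S
  have hΦ := isHomogeneous_contactForms hd hF S
  have hρ0 := exists_not_dvd_reflForms hd hirr hF hS
  have hΦ0 : ∃ i, ¬ F ∣ contactForms F S i :=
    exists_not_dvd_cross_tangentDeriv hd hirr hF hρ hρ0 (not_constant_reflForms hd hirr hF hS)
  have himgΦ := isGenericImage_caustic hd hirr hF hS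
  have himgρ := isGenericImage_reflectedImage hd hirr hF S
  have hΦc : ¬ ∃ Q : Vec, Q ≠ 0 ∧ ∀ v, eval v F = 0 → Q ⨯₃ evalVec (contactForms F S) v = 0 := by
    rintro ⟨Q, hQ, h⟩
    exact hpoint ⟨_, himgΦ.zariskiClosure_eq_singleton hirr hΦ0 hQ h⟩
  -- The equation `G` of the caustic and the equation `R` of the closure of the image.
  obtain ⟨G, n, hGn, hG, hFG, hGmin⟩ := (constant_or_exists_image_equation hirr hF hΦ (by omega)
    hΦ0).resolve_left hΦc
  obtain ⟨R, r, hRr, hR, hFR, hRmin⟩ := (constant_or_exists_image_equation hirr hF hρ (by omega)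
    hρ0).resolve_left (not_constant_reflForms hd hirr hF hS)
  have hcaustic : caustic F S = zeroLocus G := himgΦ.zariskiClosure_eq hirr hΦ0 hGn hFG hGmin
  have himage := himgρ.zariskiClosure_eq hirr hρ0 hRr hFR hRmin
  -- `B` vanishes at the points of the curve where the generic argument fails.
  obtain ⟨B, b, hB, hFB, hgen⟩ := exists_form_generic hd hirr hF hΦ0 hΦc hG hGn hGmin
  refine ⟨⟨G, n, hGn, hG, hcaustic⟩, ⟨R, r, hRr, hR, himage⟩, ?_, ?_⟩
  · refine (finite_inter hirr hF hB hFB).subset ?_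
    rintro m ⟨hm, hbad⟩
    refine ⟨hm, ?_⟩
    by_contra hBm
    obtain ⟨hmm, himm, hgrad⟩ := hgen _ hm hBm
    obtain ⟨h1, h2, htan⟩ := isTangentLine_contact hF hS hG hGn hFG hmm himm hgrad
    refine hbad ⟨_, _, fun P' => ?_, ⟨hm, ?_, ?_⟩, hcaustic ▸ htan⟩
    · rw [isCausticPoint_iff hd hF hS]
      exact ⟨fun h => h.2.2, fun h => ⟨hmm, h1, h⟩⟩
    · rwa [← evalVec_reflForms]
    · simp only [evalVec_reflForms]
  · rw [curveClass, dualCurve, hcaustic]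
    congr 1
    refine zariskiClosure_congr fun H k hH => ?_
    rw [himgρ.subset_zeroLocus_iff hirr hρ0 hH,
      tangentLines_subset_iff hirr hF hS hG hGn hFG hGmin hFB hgen hH]
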